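/- Let $k$ be a field, $R=k[x,y]$, and let $I$ be a height two ideal of $R$ minimally generated by three forms $f_1,f_2,f_3$ of the same positive degree $d$; put $\delta=d-2$ (necessarily $d\ge 2$). Let $\varphi$ be a homogeneous Hilbert–Burch matrix for $I$, i.e. a $3\times 2$ matrix over $R$ with column $m$ consisting of forms of degree $d_m$, $d_1\le d_2$, such that $0\to R^2\xrightarrow{\varphi}R^3\xrightarrow{[f_1,f_2,f_3]}I\to 0$ is exact. Let $S=k[T_1,T_2,T_3]$ and $B=R\otimes_kS=k[x,y,T_1,T_2,T_3]$, with $x,y$ of bidegree $(1,0)$ and the $T_l$ of bidegree $(0,1)$, put $[g_1,g_2]=[T_1,T_2,T_3]\,\varphi$, and let $\rho:B\to \mathrm{Sym}(I)$ be the natural surjection $T_l\mapsto f_l\in \mathrm{Sym}^1(I)$, whose kernel is $(g_1,g_2)$. Through $\rho$, $\mathrm{Sym}(I)$ is a bigraded $S$-algebra; $\mathrm{Sym}(I)_i$ denotes its $S$-submodule of $(x,y)$-degree $i$. Let $\mathcal A$ be the kernel of the natural surjection from $\mathrm{Sym}(I)$ to the Rees algebra $R[It]$, and put $\mathcal A_i=\mathcal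 A\cap \mathrm{Sym}(I)_i$ and $\mathcal A_{(i,j)}=\mathcal A\cap \mathrm{Sym}(I)_{(i,j)}$. Let $H$ be any $2\times2$ matrix over $B\otimes_SB$ with $$[\,g_1\otimes1-1\otimes g_1,\; g_2\otimes1-1\otimes g_2\,]=[\,x\otimes1-1\otimes x,\; y\otimes1-1\otimes y\,]\,H,$$ let $\Delta$ be the image of $\det H$ under $\rho\otimes\rho:B\otimes_SB\to \mathrm{Sym}(I)\otimes_S\mathrm{Sym}(I)$, and let $\mathrm{morl}_{(i,j)}\in \mathrm{Sym}(I)_i\otimes_S\mathrm{Sym}(I)_j$ be the component of $\Delta$ of $(x,y)$-bidegree $(i,j)$. Then $\Delta=\sum_{i=0}^{\delta}\mathrm{morl}_{(i,\delta-i)}$ and the $k$-vector space $\mathcal A_{(\delta,2)}$ is one-dimensional. Moreover: (1) For all $0\le i\le\delta$ and all $u\in \mathrm{Hom}_S(\mathrm{Sym}(I)_{\delta-i},S)$, the element $(1\otimes u)(\mathrm{morl}_{(i,\delta-i)})$ of $\mathrm{Sym}(I)_i$ lies in $\mathcal A_i$. Hence $\nu_1(u)=(1\otimes u)(\mathrm{morl}_{(i,\delta-i)})$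 defines an $S$-linear map $\nu_1:\mathrm{Hom}_S(\mathrm{Sym}(I)_{\delta-i},S)\to\mathcal A_i$. (2) Let $\mathrm{syl}$ be any non-zero element of $\mathcal A_{(\delta,2)}$. Then $\mu_{\mathrm{syl}}:S\to\mathcal A_\delta$, $s\mapsto s\cdot\mathrm{syl}$, is bijective. Define $\nu_2:\mathcal A_i\to\mathrm{Hom}_S(\mathrm{Sym}(I)_{\delta-i},S)$ by $\nu_2(a)(b)=\mu_{\mathrm{syl}}^{-1}(ab)$. There is a unit $\alpha$ of $k$ such that, for every $0\le i\le\delta$, $\nu_2\circ\nu_1=\alpha\cdot\mathrm{id}$ and $\nu_1\circ\nu_2=\alpha\cdot\mathrm{id}$. -/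

import Mathlib

open scoped TensorProduct

noncomputable section

namespace MorleyForms

/-- `R = k[x, y]`, with `x = X 0` and `y = X 1`. -/
abbrev R (k : Type*) [Field k] := MvPolynomial (Fin 2) k

/-- `S = k[T₁, T₂, T₃]`. -/
abbrev S (k : Type*) [Field k] := MvPolynomial (Fin 3) k

/-- `B = R ⊗ₖ S = k[x, y, T₁, T₂, T₃]`, realised as the polynomial ring `S[x, y]`. -/
abbrev B (k : Type*) [Field k] := MvPolynomial (Fin 2) (S k)

variable {k : Type*} [Field k]

/-- The ideal `I` of `R` generated by the three forms `f₀, f₁, f₂`. -/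
abbrev idealI (f : Fin 3 → R k) : Ideal (R k) := Ideal.span (Set.range f)

/-- `f l` as an element of `I`. -/
def gen (f : Fin 3 → R k) (l : Fin 3) : idealI f := ⟨f l, Ideal.subset_span ⟨l, rfl⟩⟩

/-- The row `[f₀, f₁, f₂]` as a map `R³ → R`, `v ↦ ∑ v l * f l`. -/
abbrev rowMap (f : Fin 3 → R k) : (Fin 3 → R k) →ₗ[R k] R k := Fintype.linearCombination (R k) f

/-- The standing data: `I = (f₀, f₁, f₂)` is a height two ideal of `R = k[x, y]`, minimally
generated by the three forms `f l` of the same positive degree `d`, and `φ` is a homogeneous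
Hilbert-Burch matrix for `I` (`0 → R² → R³ → I → 0` is exact, with maps `φ` and `[f₀, f₁, f₂]`)
whose columns have degrees `e 0 ≤ e 1`. -/
structure IsData (f : Fin 3 → R k) (φ : Matrix (Fin 3) (Fin 2) (R k)) (d : ℕ)
    (e : Fin 2 → ℕ) : Prop where
  deg_pos : 0 < d
  form : ∀ l, (f l).IsHomogeneous d
  height : (idealI f).height = 2
  minimal : ∀ l, f l ∉ Ideal.span (f '' {l}ᶜ)
  entries : ∀ l m, (φ l m).IsHomogeneous (e m)
  deg_le : e 0 ≤ e 1
  injective : Function.Injective φ.mulVecLin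
  exact : Function.Exact φ.mulVecLin (rowMap f)

/-- The symmetric algebra `Sym(I)` of the `R`-module `I`.  (A separate name, because its
`S`-algebra structure depends on the chosen generators `f`.) -/
def Sym (f : Fin 3 → R k) := SymmetricAlgebra (R k) (idealI f)

instance (f : Fin 3 → R k) : CommRing (Sym f) :=
  inferInstanceAs (CommRing (SymmetricAlgebra (R k) (idealI f)))

instance (f : Fin 3 → R k) : Algebra (R k) (Sym f) :=
  inferInstanceAs (Algebra (R k) (SymmetricAlgebra (R k) (idealI f)))

instance (f : Fin 3 → R k) : Algebra k (Sym f) :=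
  ((algebraMap (R k) (Sym f)).comp (algebraMap k (R k))).toAlgebra

instance (f : Fin 3 → R k) : IsScalarTower k (R k) (Sym f) :=
  IsScalarTower.of_algebraMap_eq fun _ => rfl

/-- The canonical `R`-linear map `I → Sym(I)` onto the degree one part. -/
def iota (f : Fin 3 → R k) : idealI f →ₗ[R k] Sym f := SymmetricAlgebra.ι (R k) (idealI f)

/-- `Sym(I)` is an `S`-algebra through `T l ↦ f l ∈ I = Sym¹(I)`. -/
instance (f : Fin 3 → R k) : Algebra (S k) (Sym f) :=
  (MvPolynomial.aeval (R := k) fun l => iota f (gen f l)).toRingHom.toAlgebra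

instance (f : Fin 3 → R k) : IsScalarTower k (S k) (Sym f) :=
  IsScalarTower.of_algebraMap_eq fun a =>
    ((MvPolynomial.aeval (R := k) fun l => iota f (gen f l)).commutes a).symm

/-- The natural surjection `ρ : B → Sym(I)`, `x ↦ x`, `y ↦ y`, `T l ↦ f l ∈ Sym¹(I)`. -/
def rho (f : Fin 3 → R k) : B k →ₐ[S k] Sym f :=
  MvPolynomial.aeval fun v => algebraMap (R k) (Sym f) (MvPolynomial.X v)

/-- `Sym(I)_i`: the `S`-submodule of elements of `(x, y)`-degree `i`. -/
def symDeg (f : Fin 3 → R k) (i : ℕ) : Submodule (S k) (Sym f) :=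
  (MvPolynomial.homogeneousSubmodule (Fin 2) (S k) i).map (rho f).toLinearMap

/-- The `k`-space `B_(i,j)`: `(x, y)`-degree `i` and `T`-degree `j`. -/
def bidegB (k : Type*) [Field k] (i j : ℕ) : Submodule k (B k) where
  carrier := {b | b.IsHomogeneous i ∧ ∀ m, (b.coeff m).IsHomogeneous j}
  add_mem' ha hb := ⟨ha.1.add hb.1, fun m => by
    rw [MvPolynomial.coeff_add]; exact (ha.2 m).add (hb.2 m)⟩
  zero_mem' := ⟨MvPolynomial.isHomogeneous_zero _ _ _, fun m => by
    rw [MvPolynomial.coeff_zero]; exact MvPolynomial.isHomogeneous_zero _ _ _⟩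
  smul_mem' c b hb := ⟨(MvPolynomial.homogeneousSubmodule (Fin 2) (S k) i).smul_of_tower_mem c hb.1,
    fun m => by
      rw [MvPolynomial.coeff_smul]
      exact (MvPolynomial.homogeneousSubmodule (Fin 3) k j).smul_mem c (hb.2 m)⟩

/-- The natural surjection `Sym(I) → R[It]` onto the Rees algebra, `a ∈ I ↦ a t`. -/
def toRees (f : Fin 3 → R k) : Sym f →ₐ[R k] reesAlgebra (idealI f) :=
  SymmetricAlgebra.lift
    (((Polynomial.monomial 1).comp (idealI f).subtype).codRestrict
      (Subalgebra.toSubmodule (reesAlgebra (idealI f)))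
      fun a => reesAlgebra.monomial_mem.2 (by simp))

/-- The ideal `𝒜` of `Sym(I)`: the kernel of `Sym(I) → R[It]`. -/
def idealA (f : Fin 3 → R k) : Ideal (Sym f) := RingHom.ker (toRees f)

/-- `𝒜_i = 𝒜 ∩ Sym(I)_i`, an `S`-module. -/
def degA (f : Fin 3 → R k) (i : ℕ) : Submodule (S k) (Sym f) :=
  (idealA f).restrictScalars (S k) ⊓ symDeg f i

/-- `𝒜_(i,j) = 𝒜 ∩ Sym(I)_(i,j)`, a `k`-space. -/
def bidegA (f : Fin 3 → R k) (i j : ℕ) : Submodule k (Sym f) :=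
  (idealA f).restrictScalars k ⊓ (bidegB k i j).map ((rho f).restrictScalars k).toLinearMap

lemma bidegA_le_degA (f : Fin 3 → R k) (i j : ℕ) {a : Sym f} (ha : a ∈ bidegA f i j) :
    a ∈ degA f i := by
  obtain ⟨h1, b, hb, rfl⟩ := ha
  exact ⟨h1, b, hb.1, rfl⟩

lemma mul_mem_degA (f : Fin 3 → R k) {i j n : ℕ} (h : i + j = n) {a b : Sym f}
    (ha : a ∈ degA f i) (hb : b ∈ symDeg f j) : a * b ∈ degA f n := by
  obtain ⟨h1, p, hp, rfl⟩ := ha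
  obtain ⟨q, hq, rfl⟩ := hb
  refine ⟨(idealA f).mul_mem_right _ h1, p * q, ?_, map_mul (rho f) p q⟩
  exact h ▸ MvPolynomial.IsHomogeneous.mul hp hq

/-- `[g₁, g₂] = [T₁, T₂, T₃] φ` in `B`. -/
def g (φ : Matrix (Fin 3) (Fin 2) (R k)) : Fin 2 → B k :=
  Matrix.vecMul (fun l => MvPolynomial.C (MvPolynomial.X l))
    (φ.map (MvPolynomial.map MvPolynomial.C))

/-- `b ↦ b ⊗ 1 - 1 ⊗ b` in `B ⊗_S B`. -/
def diff (b : B k) : B k ⊗[S k] B k := b ⊗ₜ 1 - 1 ⊗ₜ b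

/-- `H` is a matrix over `B ⊗_S B` with
`[g₁ ⊗ 1 - 1 ⊗ g₁, g₂ ⊗ 1 - 1 ⊗ g₂] = [x ⊗ 1 - 1 ⊗ x, y ⊗ 1 - 1 ⊗ y] H`. -/
def IsMorleyMatrix (φ : Matrix (Fin 3) (Fin 2) (R k))
    (H : Matrix (Fin 2) (Fin 2) (B k ⊗[S k] B k)) : Prop :=
  (fun m => diff (g φ m)) = Matrix.vecMul (fun v => diff (MvPolynomial.X v)) H

/-- `Δ`, the image of `det H` in `Sym(I) ⊗_S Sym(I)` under `ρ ⊗ ρ`. -/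
def Delta (f : Fin 3 → R k) (H : Matrix (Fin 2) (Fin 2) (B k ⊗[S k] B k)) :
    Sym f ⊗[S k] Sym f :=
  Algebra.TensorProduct.map (rho f) (rho f) H.det

/-- Take the homogeneous component of `(x, y)`-degree `i` and apply `ρ`. -/
def rhoDeg (f : Fin 3 → R k) (i : ℕ) : B k →ₗ[S k] symDeg f i :=
  ((rho f).toLinearMap.comp (MvPolynomial.homogeneousComponent i)).codRestrict _
    fun b => ⟨_, MvPolynomial.homogeneousComponent_isHomogeneous i b, rfl⟩

/-- The Morley form `morl_(i,j)`: the component in `Sym(I)_i ⊗_S Sym(I)_j` of the image of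
`det H`.  (`ρ` preserves degrees, so taking components before or after applying `ρ ⊗ ρ` is the
same.) -/
def morl (f : Fin 3 → R k) (H : Matrix (Fin 2) (Fin 2) (B k ⊗[S k] B k)) (i j : ℕ) :
    symDeg f i ⊗[S k] symDeg f j :=
  TensorProduct.map (rhoDeg f i) (rhoDeg f j) H.det

/-- The natural map `Sym(I)_i ⊗_S Sym(I)_j → Sym(I) ⊗_S Sym(I)`. -/
def incl (f : Fin 3 → R k) (i j : ℕ) :
    symDeg f i ⊗[S k] symDeg f j →ₗ[S k] Sym f ⊗[S k] Sym f :=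
  TensorProduct.map (symDeg f i).subtype (symDeg f j).subtype

/-- `u ↦ (1 ⊗ u)(morl_(i,j)) ∈ Sym(I)`, for `u ∈ Hom_S(Sym(I)_j, S)`. -/
def contract (f : Fin 3 → R k) (H : Matrix (Fin 2) (Fin 2) (B k ⊗[S k] B k)) (i j : ℕ) :
    (symDeg f j →ₗ[S k] S k) →ₗ[S k] Sym f :=
  (symDeg f i).subtype ∘ₗ (TensorProduct.rid (S k) (symDeg f i)).toLinearMap ∘ₗ
    (LinearMap.lTensorHom (symDeg f i)).flip (morl f H i j)

lemma contract_apply (f : Fin 3 → R k) (H : Matrix (Fin 2) (Fin 2) (B k ⊗[S k] B k)) (i j : ℕ)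
    (u : symDeg f j →ₗ[S k] S k) :
    contract f H i j u =
      (TensorProduct.rid (S k) (symDeg f i) (u.lTensor (symDeg f i) (morl f H i j)) : Sym f) :=
  rfl

/-- `ν₁ : Hom_S(Sym(I)_j, S) → 𝒜_i`, `u ↦ (1 ⊗ u)(morl_(i,j))`, once these elements are known to
lie in `𝒜_i`. -/
def nu1 (f : Fin 3 → R k) (H : Matrix (Fin 2) (Fin 2) (B k ⊗[S k] B k)) (i j : ℕ)
    (h : ∀ u, contract f H i j u ∈ degA f i) :
    (symDeg f j →ₗ[S k] S k) →ₗ[S k] degA f i :=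
  (contract f H i j).codRestrict (degA f i) h

/-- Multiplication `𝒜_i → Hom_S(Sym(I)_j, 𝒜_n)`, `a ↦ μ_a = (b ↦ a b)`, where `i + j = n`. -/
def mulA (f : Fin 3 → R k) {i j n : ℕ} (h : i + j = n) :
    degA f i →ₗ[S k] symDeg f j →ₗ[S k] degA f n :=
  LinearMap.mk₂ (S k) (fun a b => ⟨a * b, mul_mem_degA f h a.2 b.2⟩)
    (fun _ _ _ => Subtype.ext (add_mul _ _ _)) (fun _ _ _ => Subtype.ext (smul_mul_assoc _ _ _))
    (fun _ _ _ => Subtype.ext (mul_add _ _ _)) (fun _ _ _ => Subtype.ext (mul_smul_comm _ _ _))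

/-- `μ_syl : S → 𝒜_n`, `s ↦ s · syl`. -/
def muSyl (f : Fin 3 → R k) {n : ℕ} (syl : degA f n) : S k →ₗ[S k] degA f n :=
  LinearMap.toSpanSingleton (S k) (degA f n) syl

/-- `ν₂ : 𝒜_i → Hom_S(Sym(I)_j, S)`, `a ↦ μ_syl⁻¹ ∘ μ_a`, where `i + j = n` and `μ_syl : S → 𝒜_n`
is known to be bijective. -/
def nu2 (f : Fin 3 → R k) {i j n : ℕ} (h : i + j = n) (syl : degA f n)
    (hsyl : Function.Bijective (muSyl f syl)) :
    degA f i →ₗ[S k] (symDeg f j →ₗ[S k] S k) :=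
  (LinearMap.compRight (S k) (LinearEquiv.ofBijective (muSyl f syl) hsyl).symm.toLinearMap) ∘ₗ
    mulA f h

end MorleyForms

end

open MorleyForms

/-! Write g₀, g₁ for `g φ 0`, `g φ 1`. Exactness of the Hilbert–Burch complex gives Sym(I) = B/(g₀,
g₁) with g₀, g₁ coprime (`rho_eq_zero_iff`, `IsData.isRelPrime_g`). Since I contains powers of x and
y, 𝒜 is the (x, y)-power torsion of this quotient, so its socle ((g₀, g₁) : (x, y))/(g₀, g₁)
controls everything. If g_m = x P_m + y Q_m, this socle is S-free of rank one on the Sylvester form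
P₀Q₁ − P₁Q₀ (`IsData.isSocleGenerator`). For bihomogeneous P, Q its bidegree is (e₀ + e₁ − 2, 2) =
(δ, 2). As the socle sits in degree δ only, 𝒜 vanishes above δ, 𝒜_δ is free on syl, and an element
of Sym(I)_i killed by Sym(I)_{δ−i} is zero; hence ν₂ is injective.

By Cramer's rule det H carries every b ⊗ 1 − 1 ⊗ b into the ideal of the g_m ⊗ 1 − 1 ⊗ g_m, so (b ⊗
1)Δ = (1 ⊗ b)Δ, and b · ν₁(u) can be computed with b in the second factor. If deg b > δ − i the
product is zero, so ν₁(u) is torsion and lies in 𝒜_i. If deg b = δ − i only the terms of Δ with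
constant second factor survive, and b · ν₁(u) = u(b) · Δ₀ (`mul_contract`), where Δ₀ is the degree δ
part of det H with the second factor evaluated at the origin. That evaluation is again a Sylvester
form, so Δ₀ = α · syl with α a unit of k. Thus ν₂ν₁ = α, and injectivity of ν₂ gives ν₁ν₂ = α.

Finally, Δ lives in total degree δ: replacing H by its part of the expected degree alters det H only
by multiples of the g_m ⊗ 1 − 1 ⊗ g_m, because x ⊗ 1 − 1 ⊗ x and y ⊗ 1 − 1 ⊗ y have only Koszul
relations. -/

namespace MvPolynomial

/-! ### Homogeneous components of products -/

section HomogeneousComponent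

variable {σ A : Type*} [CommSemiring A]

lemma induction_on_isHomogeneous {p : MvPolynomial σ A → Prop} (b : MvPolynomial σ A)
    (h : ∀ n (b : MvPolynomial σ A), b.IsHomogeneous n → p b)
    (add : ∀ a b, p a → p b → p (a + b)) : p b := by
  induction b using MvPolynomial.induction_on' with
  | monomial u a => exact h _ _ (isHomogeneous_monomial a rfl)
  | add a b ha hb => exact add _ _ ha hb

lemma homogeneousComponent_add_mul {w : MvPolynomial σ A} {p : ℕ} (hw : w.IsHomogeneous p)
    (n : ℕ) (z : MvPolynomial σ A) :
    homogeneousComponent (p + n) (w * z) = w * homogeneousComponent n z := by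
  induction z using induction_on_isHomogeneous with
  | h m z hz =>
    rw [homogeneousComponent_of_mem (hw.mul hz), homogeneousComponent_of_mem hz]
    simp
  | add a b ha hb => rw [mul_add, map_add, ha, hb, map_add, mul_add]

lemma homogeneousComponent_mul_of_lt {w : MvPolynomial σ A} {p n : ℕ} (hw : w.IsHomogeneous p)
    (hn : n < p) (z : MvPolynomial σ A) : homogeneousComponent n (w * z) = 0 := by
  induction z using induction_on_isHomogeneous with
  | h m z hz =>
    rw [homogeneousComponent_of_mem (hw.mul hz), if_neg (by omega)]
  | add a b ha hb => rw [mul_add, map_add, ha, hb, add_zero]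

end HomogeneousComponent

/-! ### The colon ideal (g₀, g₁) : (x, y) for coprime g₀, g₁ -/

section TwoVariables

variable {A : Type*} [CommRing A]

lemma dvd_of_X_mul_eq_X_mul [IsDomain A] {σ : Type*} {i j : σ} (hij : i ≠ j)
    {a b : MvPolynomial σ A} (h : X i * a = X j * b) : ∃ r, a = X j * r ∧ b = X i * r := by
  have hj : (X j : MvPolynomial σ A) ∣ X i * a := ⟨b, h⟩
  obtain hj | ⟨r, rfl⟩ := X_prime.dvd_or_dvd hj
  · rw [X_dvd_X] at hj
    exact absurd hj hij.symm
  · refine ⟨r, rfl, mul_left_cancel₀ (X_ne_zero j) ?_⟩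
    rw [← h]; ring

lemma exists_eq_C_add_X_mul_add_X_mul (p : MvPolynomial (Fin 2) A) :
    ∃ a b, p = C (constantCoeff p) + X 0 * a + X 1 * b := by
  induction p using MvPolynomial.induction_on with
  | C a => exact ⟨0, 0, by simp⟩
  | add p q hp hq =>
    obtain ⟨a, b, h⟩ := hp
    obtain ⟨a', b', h'⟩ := hq
    refine ⟨a + a', b + b', ?_⟩
    conv_lhs => rw [h, h']
    rw [map_add, C_add]; ring
  | mul_X p i _ =>
    fin_cases i
    · exact ⟨p, 0, by simp; ring⟩
    · exact ⟨0, p, by simp; ring⟩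

lemma IsHomogeneous.constantCoeff_eq_zero {σ : Type*} {p : MvPolynomial σ A} {n : ℕ}
    (hp : p.IsHomogeneous n) (hn : 0 < n) : constantCoeff p = 0 :=
  hp.coeff_eq_zero (by simpa using hn.ne)

lemma IsHomogeneous.exists_eq_X_mul_add_X_mul {p : MvPolynomial (Fin 2) A} {n : ℕ}
    (hp : p.IsHomogeneous n) (hn : 0 < n) :
    ∃ a b : MvPolynomial (Fin 2) A, a.IsHomogeneous (n - 1) ∧ b.IsHomogeneous (n - 1) ∧
      p = X 0 * a + X 1 * b := by
  obtain ⟨a, b, h⟩ := exists_eq_C_add_X_mul_add_X_mul p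
  rw [hp.constantCoeff_eq_zero hn, C_0, zero_add] at h
  refine ⟨homogeneousComponent (n - 1) a, homogeneousComponent (n - 1) b,
    homogeneousComponent_isHomogeneous _ _, homogeneousComponent_isHomogeneous _ _, ?_⟩
  rw [← homogeneousComponent_add_mul (isHomogeneous_X A 0),
    ← homogeneousComponent_add_mul (isHomogeneous_X A 1), ← map_add, ← h,
    homogeneousComponent_of_mem hp, if_pos (by omega)]

variable [IsDomain A] [DecompositionMonoid (MvPolynomial (Fin 2) A)]
  {g P Q : Fin 2 → MvPolynomial (Fin 2) A}

/-- The colon ideal `(g₀, g₁) : (x, y)` is generated by `g₀`, `g₁` and the Sylvester form. -/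
lemma exists_eq_mul_sylvester_add (hg : IsRelPrime (g 0) (g 1))
    (hPQ : ∀ m, g m = X 0 * P m + X 1 * Q m) {b : MvPolynomial (Fin 2) A}
    (hx : X 0 * b ∈ Ideal.span (Set.range g)) (hy : X 1 * b ∈ Ideal.span (Set.range g)) :
    ∃ c, b - c * (P 0 * Q 1 - P 1 * Q 0) ∈ Ideal.span (Set.range g) := by
  have hmem : ∀ z, z ∈ Ideal.span (Set.range g) ↔ ∃ r s, r * g 0 + s * g 1 = z := by
    intro z
    have : Set.range g = {g 0, g 1} := by
      ext z; simp [Fin.exists_fin_two, eq_comm]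
    rw [this, Ideal.mem_span_pair]
  rw [hmem] at hx hy
  obtain ⟨p₀, p₁, hp⟩ := hx
  obtain ⟨q₀, q₁, hq⟩ := hy
  have hg1 : g 1 ≠ 0 := by
    intro h0
    have hu : IsUnit (g 0) := hg dvd_rfl (h0 ▸ dvd_zero _)
    have := hu.map constantCoeff
    rw [hPQ 0] at this
    simp at this
  -- Eliminating b between the expressions for x b and y b leaves a relation between g₀ and g₁. By
  -- coprimality it is a multiple c of the Koszul relation, and this c is the coefficient of the
  -- Sylvester form.
  have h1 : (X 1 * p₀ - X 0 * q₀) * g 0 = g 1 * (X 0 * q₁ - X 1 * p₁) := by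
    linear_combination X 1 * hp - X 0 * hq
  obtain ⟨c, hc⟩ : g 1 ∣ X 1 * p₀ - X 0 * q₀ :=
    hg.symm.dvd_of_dvd_mul_right ⟨_, h1⟩
  have hc' : X 0 * q₁ - X 1 * p₁ = c * g 0 := by
    refine mul_left_cancel₀ hg1 ?_
    rw [← h1, hc]; ring
  obtain ⟨r, hr, -⟩ := dvd_of_X_mul_eq_X_mul (i := (1 : Fin 2)) (j := 0) (by decide)
    (a := p₀ - c * Q 1) (b := q₀ + c * P 1) (by rw [hPQ 1] at hc; linear_combination hc)
  obtain ⟨s, hs, -⟩ := dvd_of_X_mul_eq_X_mul (i := (1 : Fin 2)) (j := 0) (by decide)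
    (a := p₁ + c * Q 0) (b := q₁ - c * P 0) (by rw [hPQ 0] at hc'; linear_combination -hc')
  -- Now p₀ = c Q₁ + x r and p₁ = −c Q₀ + x s, while Q₁ g₀ − Q₀ g₁ is x times the Sylvester form;
  -- cancel x.
  refine ⟨c, (hmem _).2 ⟨r, s, mul_left_cancel₀ (X_ne_zero (0 : Fin 2)) ?_⟩⟩
  linear_combination hp - g 0 * hr - g 1 * hs - c * Q 1 * hPQ 0 + c * Q 0 * hPQ 1

/-- Since x times the Sylvester form is Q₁ g₀ − Q₀ g₁, coprimality yields c with s Q_m ≡ c g_m ≡ c y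
Q_m modulo x for both m. As x cannot divide both Q₀ and Q₁ (it would divide g₀ and g₁), it divides s
− y c, whose constant term is s. -/
lemma eq_zero_of_C_mul_sylvester_mem (hg : IsRelPrime (g 0) (g 1))
    (hPQ : ∀ m, g m = X 0 * P m + X 1 * Q m) {s : A}
    (hs : C s * (P 0 * Q 1 - P 1 * Q 0) ∈ Ideal.span (Set.range g)) : s = 0 := by
  have hr : Set.range g = {g 0, g 1} := by
    ext z; simp [Fin.exists_fin_two, eq_comm]
  rw [hr, Ideal.mem_span_pair] at hs
  obtain ⟨r₀, r₁, h⟩ := hs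
  have hg1 : g 1 ≠ 0 := by
    intro h0
    have hu : IsUnit (g 0) := hg dvd_rfl (h0 ▸ dvd_zero _)
    have := hu.map constantCoeff
    rw [hPQ 0] at this
    simp at this
  have h1 : (C s * Q 1 - X 0 * r₀) * g 0 = g 1 * (C s * Q 0 + X 0 * r₁) := by
    linear_combination -X 0 * h + C s * Q 1 * hPQ 0 - C s * Q 0 * hPQ 1
  obtain ⟨c, hc⟩ : g 1 ∣ C s * Q 1 - X 0 * r₀ :=
    hg.symm.dvd_of_dvd_mul_right ⟨_, h1⟩
  have hc' : C s * Q 0 + X 0 * r₁ = c * g 0 := by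
    refine mul_left_cancel₀ hg1 ?_
    rw [← h1, hc]; ring
  have hx : Prime (X 0 : MvPolynomial (Fin 2) A) := X_prime
  have d1 : X 0 ∣ (C s - X 1 * c) * Q 1 :=
    ⟨r₀ + c * P 1, by rw [hPQ 1] at hc; linear_combination hc⟩
  have d0 : X 0 ∣ (C s - X 1 * c) * Q 0 :=
    ⟨-r₁ + c * P 0, by rw [hPQ 0] at hc'; linear_combination hc'⟩
  by_cases hd : X 0 ∣ C s - X 1 * c
  · obtain ⟨t, ht⟩ := hd
    simpa using congrArg constantCoeff ht
  · have e0 := (hx.dvd_or_dvd d0).resolve_left hd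
    have e1 := (hx.dvd_or_dvd d1).resolve_left hd
    refine absurd (hg (d := X 0) ?_ ?_) hx.not_isUnit
    · rw [hPQ 0]; exact dvd_add (dvd_mul_right _ _) (e0.mul_left _)
    · rw [hPQ 1]; exact dvd_add (dvd_mul_right _ _) (e1.mul_left _)

end TwoVariables

end MvPolynomial

/-! ### Height two homogeneous ideals of k[x, y] -/

namespace MvPolynomial

attribute [local instance] MvPolynomial.gradedAlgebra in
/-- A height two ideal of `k[x, y]` generated by forms contains a power of each variable. -/
lemma exists_X_pow_mem_of_height_eq_two {k : Type*} [Field k] {s : Set (MvPolynomial (Fin 2) k)}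
    (hs : ∀ p ∈ s, ∃ n, p.IsHomogeneous n) (hI : (Ideal.span s).height = 2) (v : Fin 2) :
    ∃ n, X v ^ n ∈ Ideal.span s := by
  have hom : (Ideal.span s).IsHomogeneous (homogeneousSubmodule (Fin 2) k) :=
    Ideal.homogeneous_span _ _ hs
  set m : Ideal (MvPolynomial (Fin 2) k) := RingHom.ker constantCoeff with hm
  have hmspan : m = Ideal.span {X 0, X 1} := by
    refine le_antisymm (fun p hp => ?_) (Ideal.span_le.2 ?_)
    · obtain ⟨a, b, h⟩ := exists_eq_C_add_X_mul_add_X_mul p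
      rw [show constantCoeff p = 0 from hp, C_0, zero_add] at h
      exact Ideal.mem_span_pair.2 ⟨a, b, by rw [h]; ring⟩
    · rintro _ (rfl | rfl) <;> simp [hm]
  have hmp : m.IsPrime := RingHom.ker_isPrime _
  have hmh : m.height ≤ 2 := by
    refine (Ideal.height_le_spanFinrank m hmp.ne_top).trans ?_
    rw [hmspan]
    refine (Submodule.spanFinrank_span_le_encard _).trans ?_
    exact (Set.encard_insert_le _ _).trans (by rw [Set.encard_singleton]; norm_num)
  -- The radical is the intersection of the homogeneous primes above the ideal. Each has height at
  -- least 2 and lies in (x, y), whose height is at most 2, so each equals (x, y).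
  change X v ∈ (Ideal.span s).radical
  rw [hom.radical_eq, Ideal.mem_sInf]
  rintro J ⟨hJ, hIJ, hJp⟩
  have hJm : J ≤ m := by
    intro p hp
    have h0 : homogeneousComponent 0 p ∈ J := homogeneousComponent_mem_of_mem hJ hp 0
    rw [homogeneousComponent_zero] at h0
    by_contra hne
    refine hJp.ne_top (Ideal.eq_top_of_isUnit_mem _ h0 ?_)
    exact (IsUnit.mk0 _ hne).map C
  have : J = m := Ideal.eq_of_le_of_height_le J hJm
    (hmh.trans (hI ▸ Ideal.height_mono hIJ))
  rw [this]
  simp [hm]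

end MvPolynomial

/-! ### Degrees in the Hilbert–Burch matrix -/

namespace MorleyForms

open MvPolynomial

variable {k : Type*} [Field k] {f : Fin 3 → R k} {φ : Matrix (Fin 3) (Fin 2) (R k)} {d : ℕ}
  {e : Fin 2 → ℕ}

namespace IsData

lemma exists_X_pow_mem (h : IsData f φ d e) (v : Fin 2) : ∃ n, X v ^ n ∈ idealI f := by
  refine exists_X_pow_mem_of_height_eq_two ?_ h.height v
  rintro _ ⟨l, rfl⟩
  exact ⟨d, h.form l⟩

lemma f_ne_zero (h : IsData f φ d e) (l : Fin 3) : f l ≠ 0 :=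
  fun h0 => h.minimal l (h0 ▸ zero_mem _)

lemma sum_mul_eq_zero (h : IsData f φ d e) (m : Fin 2) : ∑ l, φ l m * f l = 0 := by
  have := (h.exact (φ.mulVecLin (Pi.single m 1))).2 ⟨_, rfl⟩
  simpa [Fintype.linearCombination_apply, Matrix.mulVec_single] using this

lemma col_ne_zero (h : IsData f φ d e) (m : Fin 2) : ∃ l, φ l m ≠ 0 := by
  by_contra! h0
  have : φ.mulVecLin (Pi.single m 1) = φ.mulVecLin 0 := by
    ext1 l; simp [h0]
  simpa using congrFun (h.injective this) m

lemma exists_eq_mulVec (h : IsData f φ d e) {v : Fin 3 → R k} (hv : ∑ l, v l * f l = 0) :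
    ∃ w : Fin 2 → R k, ∀ l, v l = φ l 0 * w 0 + φ l 1 * w 1 := by
  obtain ⟨w, rfl⟩ := (h.exact v).1 (by simpa [Fintype.linearCombination_apply] using hv)
  exact ⟨w, fun l => by simp [Matrix.mulVec, dotProduct]⟩

lemma eq_zero_of_col_combination (h : IsData f φ d e) {a b : R k}
    (hab : ∀ l, φ l 0 * a + φ l 1 * b = 0) : a = 0 ∧ b = 0 := by
  have : φ.mulVecLin ![a, b] = φ.mulVecLin 0 := by
    ext1 l; simp [Matrix.mulVec, dotProduct, hab]
  exact ⟨congrFun (h.injective this) 0, congrFun (h.injective this) 1⟩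

/-- A column of degree 0 is a relation with constant coefficients, one of them a unit, so the
corresponding generator would be redundant. -/
lemma e_pos (h : IsData f φ d e) (m : Fin 2) : 0 < e m := by
  by_contra h0
  obtain ⟨l, hl⟩ := h.col_ne_zero m
  have hc := h.entries l m
  rw [Nat.eq_zero_of_not_pos h0, ← totalDegree_zero_iff_isHomogeneous,
    totalDegree_eq_zero_iff_eq_C] at hc
  have hu : coeff 0 (φ l m) ≠ 0 := fun h0 => hl (by rw [hc, h0, C_0])
  refine h.minimal l ?_
  have hs := h.sum_mul_eq_zero m
  rw [← Finset.add_sum_erase _ _ (Finset.mem_univ l), hc] at hs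
  have hf : f l = C (coeff 0 (φ l m))⁻¹ * -∑ l' ∈ Finset.univ.erase l, φ l' m * f l' := by
    rw [← eq_neg_iff_add_eq_zero.2 hs, ← mul_assoc, ← C_mul, inv_mul_cancel₀ hu, C_1, one_mul]
  rw [hf]
  refine Ideal.mul_mem_left _ _ (neg_mem (Ideal.sum_mem _ fun l' hl' => Ideal.mul_mem_left _ _ ?_))
  exact Ideal.subset_span ⟨l', by simpa using hl', rfl⟩

/-- This is where I having grade two enters: a divides c xⁿ and c yⁿ' for coprime powers of x and y
lying in I. -/
lemma dvd_of_forall_dvd_mul (h : IsData f φ d e) {a c : R k} (hc : ∀ l, a ∣ c * f l) : a ∣ c := by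
  have hI : ∀ z ∈ idealI f, a ∣ c * z := by
    intro z hz
    induction hz using Submodule.span_induction with
    | mem z hz => obtain ⟨l, rfl⟩ := hz; exact hc l
    | zero => simp
    | add x y _ _ hx hy => rw [mul_add]; exact dvd_add hx hy
    | smul r x _ hx => rw [smul_eq_mul, mul_left_comm]; exact hx.mul_left r
  obtain ⟨n, hn⟩ := h.exists_X_pow_mem 0
  obtain ⟨n', hn'⟩ := h.exists_X_pow_mem 1
  by_cases hc0 : c = 0
  · simp [hc0]
  obtain ⟨a', ha'⟩ := hI _ hn
  obtain ⟨b', hb'⟩ := hI _ hn'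
  have ha0 : a ≠ 0 := by
    rintro rfl
    exact mul_ne_zero hc0 (pow_ne_zero n (X_ne_zero 0)) (by rw [ha', zero_mul])
  have h1 : X 0 ^ n * b' = X 1 ^ n' * a' := by
    refine mul_left_cancel₀ ha0 ?_
    linear_combination X 1 ^ n' * ha' - X 0 ^ n * hb'
  have hrel : IsRelPrime (X 0 ^ n : R k) (X 1 ^ n') := by
    refine IsRelPrime.pow ?_
    refine (Irreducible.isRelPrime_iff_not_dvd X_prime.irreducible).2 fun hd => ?_
    rw [X_dvd_X] at hd
    exact absurd hd (by decide)
  obtain ⟨r, rfl⟩ := hrel.dvd_of_dvd_mul_left ⟨b', h1.symm⟩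
  refine ⟨r, mul_right_cancel₀ (pow_ne_zero n (X_ne_zero (0 : Fin 2))) ?_⟩
  rw [ha']; ring

/-- The degrees of the columns of a Hilbert-Burch matrix add up to the degree of the forms. -/
lemma e_add_e (h : IsData f φ d e) : e 0 + e 1 = d := by
  -- The signed maximal minors of φ. They are proportional to the f's; `M₀` and `f 0` are shown to
  -- divide each other, so their degrees agree.
  set M₀ := φ 1 0 * φ 2 1 - φ 2 0 * φ 1 1 with hM₀
  set M₁ := φ 2 0 * φ 0 1 - φ 0 0 * φ 2 1 with hM₁
  set M₂ := φ 0 0 * φ 1 1 - φ 1 0 * φ 0 1 with hM₂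
  have h0 := h.sum_mul_eq_zero 0
  have h1 := h.sum_mul_eq_zero 1
  rw [Fin.sum_univ_three] at h0 h1
  have c1 : f 0 * M₁ = f 1 * M₀ := by
    rw [hM₀, hM₁]; linear_combination φ 2 0 * h1 - φ 2 1 * h0
  have c2 : f 0 * M₂ = f 2 * M₀ := by
    rw [hM₀, hM₂]; linear_combination -φ 1 0 * h1 + φ 1 1 * h0
  have hd1 : f 0 ∣ M₀ := by
    refine h.dvd_of_forall_dvd_mul fun l => ?_
    fin_cases l
    · exact dvd_mul_left _ _
    · exact ⟨M₁, by simp only [Fin.mk_one]; linear_combination -c1⟩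
    · exact ⟨M₂, by simp only [Fin.reduceFinMk]; linear_combination -c2⟩
  -- The Koszul relations among the f's factor through φ. Taking 2 × 2 minors of rows 1, 2 in this
  -- factorisation writes each `f 0 * f l` as a multiple of `M₀`.
  obtain ⟨w₀, k₀⟩ := h.exists_eq_mulVec (v := ![0, f 2, -f 1]) (by
    rw [Fin.sum_univ_three]; simp; ring)
  obtain ⟨w₁, k₁⟩ := h.exists_eq_mulVec (v := ![-f 2, 0, f 0]) (by
    rw [Fin.sum_univ_three]; simp; ring)
  obtain ⟨w₂, k₂⟩ := h.exists_eq_mulVec (v := ![f 1, -f 0, 0]) (by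
    rw [Fin.sum_univ_three]; simp; ring)
  have k₀1 := k₀ 1
  have k₀2 := k₀ 2
  have k₁1 := k₁ 1
  have k₁2 := k₁ 2
  have k₂1 := k₂ 1
  have k₂2 := k₂ 2
  simp only [Matrix.cons_val] at k₀1 k₀2 k₁1 k₁2 k₂1 k₂2
  have hd2 : M₀ ∣ f 0 := by
    refine h.dvd_of_forall_dvd_mul fun l => ?_
    fin_cases l
    · exact ⟨w₁ 0 * w₂ 1 - w₁ 1 * w₂ 0, by
        simp only [Fin.zero_eta]; rw [hM₀]
        linear_combination 0 * k₁1 + (φ 1 0 * w₁ 0 + φ 1 1 * w₁ 1) * k₂2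
          - (-f 0) * k₁2 - (φ 2 0 * w₁ 0 + φ 2 1 * w₁ 1) * k₂1⟩
    · exact ⟨w₂ 0 * w₀ 1 - w₂ 1 * w₀ 0, by
        simp only [Fin.mk_one]; rw [hM₀]
        linear_combination (-f 1) * k₂1 + (φ 1 0 * w₂ 0 + φ 1 1 * w₂ 1) * k₀2
          - f 2 * k₂2 - (φ 2 0 * w₂ 0 + φ 2 1 * w₂ 1) * k₀1⟩
    · exact ⟨w₀ 0 * w₁ 1 - w₀ 1 * w₁ 0, by
        simp only [Fin.reduceFinMk]; rw [hM₀]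
        linear_combination f 0 * k₀1 + (φ 1 0 * w₀ 0 + φ 1 1 * w₀ 1) * k₁2
          - 0 * k₀2 - (φ 2 0 * w₀ 0 + φ 2 1 * w₀ 1) * k₁1⟩
  have hM : M₀ ≠ 0 := by
    intro h0
    exact h.f_ne_zero 0 (zero_dvd_iff.1 (h0 ▸ hd2))
  have hMh : M₀.IsHomogeneous (e 0 + e 1) :=
    ((h.entries 1 0).mul (h.entries 2 1)).sub ((h.entries 2 0).mul (h.entries 1 1))
  have hdeg : ∀ {a b : R k}, a ∣ b → b ≠ 0 → a.totalDegree ≤ b.totalDegree := by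
    rintro a _ ⟨c, rfl⟩ hb
    rw [totalDegree_mul_of_isDomain (left_ne_zero_of_mul hb) (right_ne_zero_of_mul hb)]
    exact Nat.le_add_right _ _
  have l1 := hdeg hd1 hM
  have l2 := hdeg hd2 (h.f_ne_zero 0)
  rw [hMh.totalDegree hM, (h.form 0).totalDegree (h.f_ne_zero 0)] at l1 l2
  exact le_antisymm l2 l1

end IsData

end MorleyForms

/-! ### Coprimality of g₀, g₁ and the presentation Sym(I) = B/(g₀, g₁) -/

namespace MorleyForms

open MvPolynomial

variable {k : Type*} [Field k] {f : Fin 3 → R k} {φ : Matrix (Fin 3) (Fin 2) (R k)} {d : ℕ}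
  {e : Fin 2 → ℕ}

/-- `B = S[x, y]` seen as the polynomial ring `R[T₁, T₂, T₃]`. -/
noncomputable abbrev swap (k : Type*) [Field k] : B k ≃ₐ[k] MvPolynomial (Fin 3) (R k) :=
  commAlgEquiv k (Fin 2) (Fin 3)

lemma swap_map_C (p : R k) : swap k (map C p) = C p := by
  have : map C p = (swap k).symm (C p) := (commAlgEquiv_C p).symm
  rw [this, AlgEquiv.apply_symm_apply]

lemma g_eq_sum (φ : Matrix (Fin 3) (Fin 2) (R k)) (m : Fin 2) :
    g φ m = ∑ l, C (X l) * map C (φ l m) := by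
  simp [g, Matrix.vecMul, dotProduct]

lemma swap_g (φ : Matrix (Fin 3) (Fin 2) (R k)) (m : Fin 2) :
    swap k (g φ m) = ∑ l, X l * C (φ l m) := by
  rw [g_eq_sum, map_sum]
  refine Finset.sum_congr rfl fun l _ => ?_
  rw [map_mul, swap_map_C, commAlgEquiv_C_X]

lemma coeff_swap_g (φ : Matrix (Fin 3) (Fin 2) (R k)) (m : Fin 2) (l : Fin 3) :
    coeff (Finsupp.single l 1) (swap k (g φ m)) = φ l m := by
  rw [swap_g, coeff_sum, Finset.sum_eq_single l]
  · rw [mul_comm, coeff_C_mul]; simp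
  · intro l' _ hl'
    rw [mul_comm, coeff_C_mul, coeff_X, if_neg, mul_zero]
    simpa [Finsupp.single_left_inj] using hl'
  · simp

lemma swap_g_isHomogeneous (φ : Matrix (Fin 3) (Fin 2) (R k)) (m : Fin 2) :
    (swap k (g φ m)).IsHomogeneous 1 := by
  rw [swap_g]
  exact IsHomogeneous.sum _ _ _ fun l _ => (isHomogeneous_X _ l).mul (isHomogeneous_C _ _)

lemma coeff_coeff_swap (b : B k) (m : Fin 2 →₀ ℕ) (n : Fin 3 →₀ ℕ) :
    coeff m (coeff n (swap k b)) = coeff n (coeff m b) := by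
  induction b using MvPolynomial.induction_on' with
  | add p q hp hq => simp only [map_add, coeff_add, hp, hq]
  | monomial u a =>
    induction a using MvPolynomial.induction_on' with
    | add p q hp hq => simp only [map_add, coeff_add, hp, hq]
    | monomial v c =>
      have : swap k (monomial u (monomial v c)) = monomial v (monomial u c) := by
        simp [commAlgEquiv, monomial]
      rw [this]
      simp only [coeff_monomial]
      split_ifs <;> simp_all

lemma swap_isHomogeneous {b : B k} {j : ℕ} (hb : ∀ m, (b.coeff m).IsHomogeneous j) :
    (swap k b).IsHomogeneous j := by
  rw [IsHomogeneous, IsWeightedHomogeneous]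
  intro n hn
  obtain ⟨m, hm⟩ := MvPolynomial.ne_zero_iff.1 hn
  rw [coeff_coeff_swap] at hm
  exact hb m hm

lemma mul_mem_bidegB {i j i' j' : ℕ} {b c : B k} (hb : b ∈ bidegB k i j) (hc : c ∈ bidegB k i' j') :
    b * c ∈ bidegB k (i + i') (j + j') := by
  refine ⟨hb.1.mul hc.1, fun m => ?_⟩
  rw [coeff_mul]
  exact IsHomogeneous.sum _ _ _ fun p _ => (hb.2 _).mul (hc.2 _)

namespace IsData

lemma swap_g_ne_zero (h : IsData f φ d e) (m : Fin 2) : swap k (g φ m) ≠ 0 := by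
  intro h0
  obtain ⟨l, hl⟩ := h.col_ne_zero m
  rw [← coeff_swap_g φ m l, h0] at hl
  exact hl rfl

/-- The first column divided by r is still a relation on the f's, hence a combination of the
columns; injectivity of φ forces r to be invertible. -/
lemma isUnit_of_forall_dvd (h : IsData f φ d e) {r : R k} (hr : ∀ l, r ∣ φ l 0) : IsUnit r := by
  choose c hc using hr
  have hr0 : r ≠ 0 := by
    rintro rfl
    obtain ⟨l, hl⟩ := h.col_ne_zero 0
    exact hl (by rw [hc l, zero_mul])
  obtain ⟨w, hw⟩ := h.exists_eq_mulVec (v := c) (by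
    refine mul_left_cancel₀ hr0 ?_
    rw [mul_zero, ← h.sum_mul_eq_zero 0, Finset.mul_sum]
    exact Finset.sum_congr rfl fun l _ => by rw [hc l, mul_assoc])
  obtain ⟨h0, -⟩ := h.eq_zero_of_col_combination (a := r * w 0 - 1) (b := r * w 1) fun l => by
    linear_combination -r * hw l - hc l
  exact IsUnit.of_mul_eq_one _ (sub_eq_zero.1 h0)

/-- Over R the g's are linear in the T's. A common divisor of T-degree 0 divides the first column of
φ, hence is a unit; one of T-degree 1 would have cofactors in R and make the columns of φ linearly
dependent. -/
lemma isRelPrime_g (h : IsData f φ d e) : IsRelPrime (g φ 0) (g φ 1) := by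
  intro b hb0 hb1
  rw [← MulEquiv.isUnit_map (swap k)]
  obtain ⟨q₀, h0⟩ := map_dvd (swap k) hb0
  obtain ⟨q₁, h1⟩ := map_dvd (swap k) hb1
  generalize swap k b = t at h0 h1 ⊢
  have key : ∀ {m q}, swap k (g φ m) = t * q → t.totalDegree + q.totalDegree = 1 := by
    intro m q hq
    have hne := h.swap_g_ne_zero m
    have := (swap_g_isHomogeneous φ m).totalDegree hne
    rw [hq] at hne this
    rwa [totalDegree_mul_of_isDomain (left_ne_zero_of_mul hne) (right_ne_zero_of_mul hne)] at this
  have k0 := key h0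
  have k1 := key h1
  by_cases ht : t.totalDegree = 0
  · rw [totalDegree_eq_zero_iff_eq_C] at ht
    rw [ht]
    refine (h.isUnit_of_forall_dvd fun l => ⟨coeff (Finsupp.single l 1) q₀, ?_⟩).map C
    rw [← coeff_swap_g φ 0 l, h0]
    conv_lhs => rw [ht, coeff_C_mul]
  · have e0 := totalDegree_eq_zero_iff_eq_C.1 (show q₀.totalDegree = 0 by omega)
    have e1 := totalDegree_eq_zero_iff_eq_C.1 (show q₁.totalDegree = 0 by omega)
    have c0 : ∀ l, φ l 0 = coeff (Finsupp.single l 1) t * coeff 0 q₀ := fun l => by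
      rw [← coeff_swap_g φ 0 l, h0, e0, mul_comm, coeff_C_mul, coeff_C, if_pos rfl, mul_comm]
    have c1 : ∀ l, φ l 1 = coeff (Finsupp.single l 1) t * coeff 0 q₁ := fun l => by
      rw [← coeff_swap_g φ 1 l, h1, e1, mul_comm, coeff_C_mul, coeff_C, if_pos rfl, mul_comm]
    obtain ⟨-, hz⟩ := h.eq_zero_of_col_combination (a := coeff 0 q₁) (b := -coeff 0 q₀) fun l => by
      rw [c0, c1]; ring
    refine absurd ?_ (h.swap_g_ne_zero 0)
    rw [h0, e0, neg_eq_zero.1 hz, C_0, mul_zero]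

lemma g_isHomogeneous (h : IsData f φ d e) (m : Fin 2) : (g φ m).IsHomogeneous (e m) := by
  rw [g_eq_sum]
  refine IsHomogeneous.sum _ _ _ fun l _ => ?_
  rw [← zero_add (e m)]
  exact (isHomogeneous_C _ _).mul ((h.entries l m).map C)

lemma exists_bihomogeneous_decomposition (h : IsData f φ d e) (m : Fin 2) :
    ∃ P Q : B k, P ∈ bidegB k (e m - 1) 1 ∧ Q ∈ bidegB k (e m - 1) 1 ∧
      g φ m = X 0 * P + X 1 * Q := by
  choose p q hp hq hpq using fun l => (h.entries l m).exists_eq_X_mul_add_X_mul (h.e_pos m)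
  have key : ∀ p : Fin 3 → R k, (∀ l, (p l).IsHomogeneous (e m - 1)) →
      ∑ l, C (X l) * map C (p l) ∈ bidegB k (e m - 1) 1 := by
    refine fun p hp => sum_mem fun l _ => ⟨?_, fun n => ?_⟩
    · rw [← zero_add (e m - 1)]
      exact (isHomogeneous_C _ _).mul ((hp l).map C)
    · rw [coeff_C_mul, coeff_map]
      exact (isHomogeneous_X _ l).mul (isHomogeneous_C _ _)
  refine ⟨_, _, key p hp, key q hq, ?_⟩
  rw [g_eq_sum, Finset.mul_sum, Finset.mul_sum, ← Finset.sum_add_distrib]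
  refine Finset.sum_congr rfl fun l _ => ?_
  rw [hpq, map_add, map_mul, map_mul, map_X, map_X]
  ring

end IsData

/-- The ideal `(g₁, g₂)` of `B`. -/
noncomputable abbrev idealG (φ : Matrix (Fin 3) (Fin 2) (R k)) : Ideal (B k) :=
  Ideal.span (Set.range (g φ))

lemma g_mem_idealG (φ : Matrix (Fin 3) (Fin 2) (R k)) (m : Fin 2) : g φ m ∈ idealG φ :=
  Ideal.subset_span ⟨m, rfl⟩

lemma rho_C (f : Fin 3 → R k) (s : S k) : rho f (C s) = algebraMap (S k) (Sym f) s :=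
  (rho f).commutes s

lemma rho_C_X (f : Fin 3 → R k) (l : Fin 3) : rho f (C (X l)) = iota f (gen f l) := by
  rw [rho_C]
  exact aeval_X _ l

lemma rho_map_C (f : Fin 3 → R k) (p : R k) : rho f (map C p) = algebraMap (R k) (Sym f) p := by
  induction p using MvPolynomial.induction_on with
  | C a =>
    rw [map_C, rho_C]
    exact aeval_C _ a
  | add p q hp hq => rw [map_add, map_add, hp, hq, map_add]
  | mul_X p v hp =>
    rw [map_mul, map_mul, hp, map_X, map_mul]
    congr 1
    exact aeval_X _ v

lemma rho_g (h : IsData f φ d e) (m : Fin 2) : rho f (g φ m) = 0 := by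
  have hs := h.sum_mul_eq_zero m
  rw [g_eq_sum, map_sum]
  have : ∀ l, rho f (C (X l) * map C (φ l m)) = iota f (φ l m • gen f l) := fun l => by
    rw [map_mul, rho_C_X, rho_map_C, map_smul, Algebra.smul_def, mul_comm]
  rw [Finset.sum_congr rfl fun l _ => this l, ← map_sum]
  convert map_zero (iota f)
  ext1
  simpa [gen] using hs

/-- The linear form `∑ v l * T l` of `B` with coefficients in `R`. -/
noncomputable def linForm (v : Fin 3 → R k) : B k := ∑ l, C (X l) * map C (v l)

lemma linForm_add (v w : Fin 3 → R k) : linForm (v + w) = linForm v + linForm w := by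
  simp only [linForm, Pi.add_apply, map_add, mul_add, Finset.sum_add_distrib]

lemma linForm_sub (v w : Fin 3 → R k) : linForm (v - w) = linForm v - linForm w := by
  rw [eq_sub_iff_add_eq, ← linForm_add, sub_add_cancel]

lemma linForm_smul (r : R k) (v : Fin 3 → R k) : linForm (r • v) = map C r * linForm v := by
  simp only [linForm, Finset.mul_sum]
  refine Finset.sum_congr rfl fun l _ => ?_
  rw [Pi.smul_apply, smul_eq_mul, map_mul]
  ring

lemma linForm_single (l : Fin 3) : linForm (Pi.single l 1 : Fin 3 → R k) = C (X l) := by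
  rw [linForm, Finset.sum_eq_single l]
  · rw [Pi.single_eq_same, map_one, mul_one]
  · intro l' _ hl'
    rw [Pi.single_eq_of_ne hl', map_zero, mul_zero]
  · simp

lemma linForm_mem_idealG (h : IsData f φ d e) {v : Fin 3 → R k} (hv : ∑ l, v l * f l = 0) :
    linForm v ∈ idealG φ := by
  obtain ⟨w, hw⟩ := h.exists_eq_mulVec hv
  have : linForm v = map C (w 0) * g φ 0 + map C (w 1) * g φ 1 := by
    rw [linForm, g_eq_sum, g_eq_sum, Finset.mul_sum, Finset.mul_sum, ← Finset.sum_add_distrib]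
    refine Finset.sum_congr rfl fun l _ => ?_
    rw [hw l, map_add, map_mul, map_mul]
    ring
  rw [this]
  exact add_mem (Ideal.mul_mem_left _ _ (g_mem_idealG φ 0))
    (Ideal.mul_mem_left _ _ (g_mem_idealG φ 1))

lemma exists_sum_mul_eq (z : idealI f) : ∃ v : Fin 3 → R k, ∑ l, v l * f l = z :=
  (Submodule.mem_span_range_iff_exists_fun (R k)).1 z.2

/-- There is an `R`-linear map `I → B/(g₁, g₂)` with `f l ↦ T l`. -/
lemma exists_addMonoidHom_quotient (h : IsData f φ d e) :
    ∃ ψ : idealI f →+ B k ⧸ idealG φ,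
      (∀ (r : R k) z, ψ (r • z) = Ideal.Quotient.mk (idealG φ) (map C r) * ψ z) ∧
      ∀ l, ψ (gen f l) = Ideal.Quotient.mk (idealG φ) (C (X l)) := by
  choose c hc using exists_sum_mul_eq (f := f)
  -- Two expressions of z in the generators differ by a syzygy, whose linear form lies in (g₀, g₁);
  -- so the arbitrary choice c does not matter.
  have hwell : ∀ v (z : idealI f), ∑ l, v l * f l = z →
      Ideal.Quotient.mk (idealG φ) (linForm (c z)) = Ideal.Quotient.mk (idealG φ) (linForm v) := by
    intro v z hv
    rw [Ideal.Quotient.eq, ← linForm_sub]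
    refine linForm_mem_idealG h ?_
    simp only [Pi.sub_apply, sub_mul, Finset.sum_sub_distrib, hc, hv, sub_self]
  refine ⟨AddMonoidHom.mk' (fun z => Ideal.Quotient.mk (idealG φ) (linForm (c z)))
    fun z w => ?_, fun r z => ?_, fun l => ?_⟩
  · rw [← map_add, ← linForm_add]
    refine hwell _ _ ?_
    simp only [Pi.add_apply, add_mul, Finset.sum_add_distrib, hc, Submodule.coe_add]
  · simp only [AddMonoidHom.mk'_apply]
    rw [← map_mul, ← linForm_smul]
    refine hwell _ _ ?_
    simp only [Pi.smul_apply, smul_eq_mul, mul_assoc, ← Finset.mul_sum, hc, Submodule.coe_smul]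
  · rw [AddMonoidHom.mk'_apply, ← linForm_single]
    refine hwell _ _ ?_
    rw [Finset.sum_eq_single l]
    · rw [Pi.single_eq_same, one_mul]; rfl
    · intro l' _ hl'
      rw [Pi.single_eq_of_ne hl', zero_mul]
    · simp

/-- The universal property of `Sym(I)` as a quotient of `B`. -/
lemma exists_ringHom_comp_rho {A : Type*} [CommRing A] (q : B k →+* A) (ψ : idealI f →+ A)
    (hψ : ∀ (r : R k) z, ψ (r • z) = q (map C r) * ψ z) (hψl : ∀ l, ψ (gen f l) = q (C (X l))) :
    ∃ Ψ : Sym f →+* A, ∀ b, Ψ (rho f b) = q b := by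
  let _ : Algebra (R k) A := (q.comp (map C)).toAlgebra
  let ψ' : idealI f →ₗ[R k] A :=
    { ψ with map_smul' := fun r z => (hψ r z).trans (Algebra.smul_def r (ψ z)).symm }
  let Ψ : Sym f →ₐ[R k] A := SymmetricAlgebra.lift ψ'
  have hr : ∀ r, Ψ (rho f (map C r)) = q (map C r) := fun r => by
    rw [rho_map_C]; exact Ψ.commutes r
  refine ⟨Ψ, fun b => ?_⟩
  have hΨ : (Ψ : Sym f →+* A).comp (rho f : B k →+* Sym f) = q := by
    refine MvPolynomial.ringHom_ext' (MvPolynomial.ringHom_ext' ?_ fun l => ?_) fun v => ?_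
    · refine RingHom.ext fun a => ?_
      have := hr (C a)
      rwa [map_C] at this
    · change Ψ (rho f (C (X l))) = q (C (X l))
      rw [rho_C_X, ← hψl]
      exact SymmetricAlgebra.lift_ι_apply (f := ψ') (gen f l)
    · have := hr (X v)
      rwa [map_X] at this
  exact RingHom.congr_fun hΨ b

/-- The kernel of `ρ` is `(g₁, g₂)`. -/
lemma rho_eq_zero_iff (h : IsData f φ d e) {b : B k} : rho f b = 0 ↔ b ∈ idealG φ := by
  refine ⟨fun hb => ?_, fun hb => ?_⟩
  · obtain ⟨ψ, hψ, hψl⟩ := exists_addMonoidHom_quotient h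
    obtain ⟨Ψ, hΨ⟩ := exists_ringHom_comp_rho (f := f) (A := B k ⧸ idealG φ)
      (Ideal.Quotient.mk (idealG φ)) ψ hψ hψl
    rw [← Ideal.Quotient.eq_zero_iff_mem, ← hΨ, hb, map_zero]
  · have : idealG φ ≤ RingHom.ker (rho f) := by
      rw [Ideal.span_le]
      rintro _ ⟨m, rfl⟩
      exact rho_g h m
    exact this hb

lemma rho_surjective (f : Fin 3 → R k) : Function.Surjective (rho f) := by
  intro a
  refine SymmetricAlgebra.induction (R := R k) (M := idealI f) (motive := fun a => ∃ b, rho f b = a)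
    (fun r => ⟨_, rho_map_C f r⟩) (fun z => ?_) (fun a b ha hb => ?_) (fun a b ha hb => ?_) a
  · obtain ⟨v, hv⟩ := (Submodule.mem_span_range_iff_exists_fun (R k)).1 z.2
    refine ⟨linForm v, ?_⟩
    have hz : z = ∑ l, v l • gen f l := by
      ext1; simp [← hv, gen]
    change _ = iota f z
    rw [hz, linForm, map_sum, map_sum]
    refine Finset.sum_congr rfl fun l _ => ?_
    rw [map_mul, rho_C_X, rho_map_C, map_smul, Algebra.smul_def, mul_comm]
  · obtain ⟨x, rfl⟩ := ha
    obtain ⟨y, rfl⟩ := hb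
    exact ⟨x * y, map_mul _ _ _⟩
  · obtain ⟨x, rfl⟩ := ha
    obtain ⟨y, rfl⟩ := hb
    exact ⟨x + y, map_add _ _ _⟩

end MorleyForms

namespace MvPolynomial

lemma IsHomogeneous.aeval_mul {σ A B : Type*} [CommSemiring A] [CommSemiring B] [Algebra A B]
    {p : MvPolynomial σ A} {n : ℕ} (hp : p.IsHomogeneous n) (c : B) (x : σ → B) :
    MvPolynomial.aeval (fun l => c * x l) p = c ^ n * MvPolynomial.aeval x p := by
  rw [aeval_def, aeval_def, eval₂_eq, eval₂_eq, Finset.mul_sum]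
  refine Finset.sum_congr rfl fun m hm => ?_
  rw [hp.degree_eq_sum_deg_support hm, mul_left_comm, ← Finset.prod_pow_eq_pow_sum,
    ← Finset.prod_mul_distrib]
  simp only [mul_pow]

end MvPolynomial

namespace MorleyForms

open MvPolynomial

variable {k : Type*} [Field k] {f : Fin 3 → R k} {φ : Matrix (Fin 3) (Fin 2) (R k)} {d : ℕ}
  {e : Fin 2 → ℕ}

/-! ### 𝒜 as the torsion of Sym(I) -/

section Torsion

lemma rho_eq_aeval_swap (f : Fin 3 → R k) (b : B k) :
    rho f b = aeval (fun l => iota f (gen f l)) (swap k b) := by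
  have : (rho f : B k →+* Sym f) = ((aeval (R := R k) fun l => iota f (gen f l) :
      MvPolynomial (Fin 3) (R k) →ₐ[R k] Sym f) : MvPolynomial (Fin 3) (R k) →+* Sym f).comp
        (swap k : B k →+* MvPolynomial (Fin 3) (R k)) := by
    refine MvPolynomial.ringHom_ext' (MvPolynomial.ringHom_ext' ?_ fun l => ?_) fun v => ?_
    · refine RingHom.ext fun a => ?_
      have h1 := rho_map_C f (C a)
      have h2 := swap_map_C (C a : R k)
      rw [map_C] at h1 h2
      simp only [RingHom.comp_apply, RingHom.coe_coe]
      rw [h1, h2, aeval_C]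
    · simp only [RingHom.comp_apply, RingHom.coe_coe]
      rw [rho_C_X, commAlgEquiv_C_X, aeval_X]
    · have h1 := rho_map_C f (X v)
      have h2 := swap_map_C (X v : R k)
      rw [map_X] at h1 h2
      simp only [RingHom.comp_apply, RingHom.coe_coe]
      rw [h1, h2, aeval_C]
  exact RingHom.congr_fun this b

lemma iota_mul_comm (f : Fin 3 → R k) (a b : idealI f) :
    algebraMap (R k) (Sym f) a * iota f b = iota f a * algebraMap (R k) (Sym f) b := by
  rw [← Algebra.smul_def, ← map_smul, mul_comm, ← Algebra.smul_def, ← map_smul]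
  congr 1
  ext1
  exact mul_comm _ _

/-- In Sym(I) one has c · [f_l] = [c] · f_l, because both are the class of c f_l. Consequently, up
to a power of c, a form p in the T's vanishes in Sym(I) once p(f) = 0. -/
lemma pow_mul_aeval_iota (c : idealI f) {p : MvPolynomial (Fin 3) (R k)} {n : ℕ}
    (hp : p.IsHomogeneous n) :
    algebraMap (R k) (Sym f) c ^ n * aeval (fun l => iota f (gen f l)) p =
      iota f c ^ n * algebraMap (R k) (Sym f) (aeval f p) := by
  rw [← hp.aeval_mul, ← aeval_algebraMap_apply, ← hp.aeval_mul]
  congr 2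
  ext1 l
  exact iota_mul_comm f c (gen f l)

lemma coe_toRees_iota (f : Fin 3 → R k) (a : idealI f) :
    (toRees f (iota f a) : Polynomial (R k)) = Polynomial.monomial 1 (a : R k) := by
  exact congrArg (fun z : reesAlgebra (idealI f) => (z : Polynomial (R k)))
    (SymmetricAlgebra.lift_ι_apply (R := R k) (M := idealI f) (f := _) a)

lemma coe_toRees_aeval_iota {p : MvPolynomial (Fin 3) (R k)} {n : ℕ} (hp : p.IsHomogeneous n) :
    (toRees f (aeval (fun l => iota f (gen f l)) p) : Polynomial (R k)) =
      Polynomial.X ^ n * Polynomial.C (aeval f p) := by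
  have h1 : ((reesAlgebra (idealI f)).val.comp (toRees f))
      (aeval (fun l => iota f (gen f l)) p) =
      aeval (fun l => Polynomial.X * algebraMap (R k) (Polynomial (R k)) (f l)) p := by
    rw [comp_aeval_apply]
    congr 2
    ext1 l
    refine (coe_toRees_iota f (gen f l)).trans ?_
    rw [← Polynomial.C_mul_X_eq_monomial, mul_comm]
    rfl
  refine h1.trans ?_
  rw [hp.aeval_mul]
  exact congrArg _ (aeval_algebraMap_apply (Polynomial (R k)) f p)

/-- The image in R[It] separates T-degrees, so every T-component of a representative vanishes at f;
its T-degree then bounds the power of c needed. -/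
lemma exists_pow_mul_eq_zero {a : Sym f} (ha : a ∈ idealA f) (c : idealI f) :
    ∃ N, algebraMap (R k) (Sym f) c ^ N * a = 0 := by
  obtain ⟨b, rfl⟩ := rho_surjective f a
  rw [rho_eq_aeval_swap] at ha ⊢
  generalize swap k b = p at ha ⊢
  have h0 : ∀ n, aeval f (homogeneousComponent n p) = 0 := by
    intro n
    have h1 : (toRees f (aeval (fun l => iota f (gen f l)) p) : Polynomial (R k)) = 0 := by
      rw [show toRees f _ = 0 from ha]; rfl
    by_cases hn : n ∈ Finset.range (p.totalDegree + 1)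
    · conv_lhs at h1 => rw [← sum_homogeneousComponent p]
      rw [map_sum, map_sum, AddSubmonoidClass.coe_finsetSum] at h1
      have h2 := congrArg (fun q => Polynomial.coeff q n) h1
      simp only [coe_toRees_aeval_iota (homogeneousComponent_isHomogeneous _ p),
        Polynomial.finsetSum_coeff, Polynomial.coeff_zero] at h2
      rw [Finset.sum_eq_single n] at h2
      · simpa using h2
      · intro m _ hm
        rw [mul_comm, Polynomial.coeff_C_mul, Polynomial.coeff_X_pow, if_neg hm.symm, mul_zero]
      · exact fun h => absurd hn h
    · rw [homogeneousComponent_eq_zero _ _ (by simpa [Nat.lt_succ_iff] using hn), map_zero]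
  refine ⟨p.totalDegree, ?_⟩
  suffices hs : ∀ N, N = p.totalDegree → algebraMap (R k) (Sym f) c ^ N *
      aeval (fun l => iota f (gen f l)) (∑ n ∈ Finset.range (N + 1), homogeneousComponent n p) = 0 by
    have := hs _ rfl
    rwa [sum_homogeneousComponent] at this
  intro N hN
  rw [map_sum, Finset.mul_sum]
  refine Finset.sum_eq_zero fun n hn => ?_
  have hn' : n ≤ N := Nat.lt_succ_iff.1 (Finset.mem_range.1 hn)
  rw [← Nat.sub_add_cancel hn', pow_add, mul_assoc,
    pow_mul_aeval_iota c (homogeneousComponent_isHomogeneous n p), h0]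
  simp

/-- The Rees algebra is a domain containing R, so R-torsion maps to zero in it. -/
lemma mem_idealA_of_mul_eq_zero {r : R k} (hr : r ≠ 0) {a : Sym f}
    (ha : algebraMap (R k) (Sym f) r * a = 0) : a ∈ idealA f := by
  have h1 := congrArg (toRees f) ha
  rw [map_mul, map_zero, AlgHom.commutes] at h1
  refine (mul_eq_zero.1 h1).resolve_left fun h2 => hr ?_
  have h3 := congrArg (fun z : reesAlgebra (idealI f) => (z : Polynomial (R k))) h2
  exact Polynomial.C_eq_zero.1 h3

end Torsion

/-! ### The socle of B/(g₀, g₁) and its degree -/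

section Socle

attribute [local instance] MvPolynomial.gradedAlgebra in
lemma IsData.homogeneousComponent_mem (h : IsData f φ d e) {b : B k} (hb : b ∈ idealG φ) (n : ℕ) :
    homogeneousComponent n b ∈ idealG φ := by
  refine homogeneousComponent_mem_of_mem (Ideal.homogeneous_span _ _ ?_) hb n
  rintro _ ⟨m, rfl⟩
  exact ⟨e m, h.g_isHomogeneous m⟩

/-- `D` freely generates `((g₁, g₂) : (x, y)) / (g₁, g₂)` over `S`. -/
structure IsSocleGenerator (φ : Matrix (Fin 3) (Fin 2) (R k)) (D : B k) : Prop where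
  X_mul_mem : ∀ v, X v * D ∈ idealG φ
  exists_sub_mem : ∀ b, (∀ v, X v * b ∈ idealG φ) → ∃ s : S k, b - C s * D ∈ idealG φ
  eq_zero : ∀ s : S k, C s * D ∈ idealG φ → s = 0

instance : DecompositionMonoid (B k) := inferInstance

lemma IsData.isSocleGenerator (h : IsData f φ d e) {P Q : Fin 2 → B k}
    (hPQ : ∀ m, g φ m = X 0 * P m + X 1 * Q m) :
    IsSocleGenerator φ (P 0 * Q 1 - P 1 * Q 0) := by
  have hX : ∀ v, X v * (P 0 * Q 1 - P 1 * Q 0) ∈ idealG φ := by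
    intro v
    fin_cases v
    · convert sub_mem (Ideal.mul_mem_left _ (Q 1) (g_mem_idealG φ 0))
        (Ideal.mul_mem_left _ (Q 0) (g_mem_idealG φ 1)) using 1
      rw [hPQ, hPQ, Fin.zero_eta]; ring
    · convert sub_mem (Ideal.mul_mem_left _ (P 0) (g_mem_idealG φ 1))
        (Ideal.mul_mem_left _ (P 1) (g_mem_idealG φ 0)) using 1
      rw [hPQ, hPQ, Fin.mk_one]; ring
  refine ⟨hX, fun b hb => ?_, fun s hs => eq_zero_of_C_mul_sylvester_mem h.isRelPrime_g hPQ hs⟩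
  obtain ⟨c, hc⟩ := exists_eq_mul_sylvester_add h.isRelPrime_g hPQ (hb 0) (hb 1)
  -- Modulo (g₀, g₁) the Sylvester form is killed by x and y, so only the constant term of its
  -- coefficient c counts.
  obtain ⟨a, a', ha⟩ := exists_eq_C_add_X_mul_add_X_mul c
  refine ⟨constantCoeff c, ?_⟩
  convert add_mem hc (add_mem (Ideal.mul_mem_left _ a (hX 0)) (Ideal.mul_mem_left _ a' (hX 1)))
    using 1
  linear_combination (P 0 * Q 1 - P 1 * Q 0) * ha

/-- Two generators of a free S-module of rank one differ by a unit of S, and those units are the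
nonzero constants. -/
lemma IsSocleGenerator.exists_unit {D D' : B k} (hD : IsSocleGenerator φ D)
    (hD' : IsSocleGenerator φ D') : ∃ c : kˣ, D' - C (C (c : k)) * D ∈ idealG φ := by
  obtain ⟨s, hs⟩ := hD.exists_sub_mem D' hD'.X_mul_mem
  obtain ⟨t, ht⟩ := hD'.exists_sub_mem D hD.X_mul_mem
  have hst : 1 - t * s = 0 := hD.eq_zero _ (by
    convert add_mem ht (Ideal.mul_mem_left _ (C t) hs) using 1
    rw [C_sub, C_mul, C_1]; ring)
  have hu : IsUnit s := IsUnit.of_mul_eq_one t (by rw [mul_comm]; exact (sub_eq_zero.1 hst).symm)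
  obtain ⟨c, hc, rfl⟩ := (isUnit_iff_eq_C_of_isReduced).1 hu
  obtain ⟨c, rfl⟩ := hc
  exact ⟨c, hs⟩

lemma IsData.exists_bihomogeneous_isSocleGenerator (h : IsData f φ d e) :
    ∃ D ∈ bidegB k (d - 2) 2, IsSocleGenerator φ D := by
  choose P Q hP hQ hPQ using h.exists_bihomogeneous_decomposition
  refine ⟨P 0 * Q 1 - P 1 * Q 0, ?_, h.isSocleGenerator hPQ⟩
  have hd : d - 2 = e 0 - 1 + (e 1 - 1) := by
    have := h.e_add_e
    have := h.e_pos 0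
    have := h.e_pos 1
    omega
  rw [hd]
  refine sub_mem (mul_mem_bidegB (hP 0) (hQ 1)) ?_
  rw [add_comm (e 0 - 1)]
  exact mul_mem_bidegB (hP 1) (hQ 0)

variable {D : B k}

/-- The socle is generated in degree δ over S, whose elements have (x, y)-degree 0; so it has no
component in another degree. -/
lemma mem_idealG_of_X_mul_mem (h : IsData f φ d e) {p : B k} {i : ℕ} (hp : p.IsHomogeneous i)
    (hi : i ≠ d - 2) (hX : ∀ v, X v * p ∈ idealG φ) : p ∈ idealG φ := by
  obtain ⟨D, hDb, hD⟩ := h.exists_bihomogeneous_isSocleGenerator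
  obtain ⟨s, hs⟩ := hD.exists_sub_mem p hX
  have := h.homogeneousComponent_mem hs i
  rwa [map_sub, homogeneousComponent_eq_self hp, homogeneousComponent_C_mul,
    homogeneousComponent_of_mem hDb.1, if_neg hi, mul_zero, sub_zero] at this

lemma mem_idealG_of_X_pow_mul_mem (h : IsData f φ d e) {p : B k} {i : ℕ} (hp : p.IsHomogeneous i)
    (hi : d - 2 < i) (m n : ℕ) (h0 : X 0 ^ m * p ∈ idealG φ) (h1 : X 1 ^ n * p ∈ idealG φ) :
    p ∈ idealG φ := by
  induction hN : m + n generalizing m n p i with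
  | zero =>
    rw [Nat.add_eq_zero_iff] at hN
    simpa [hN.1] using h0
  | succ N ih =>
    rcases m with _ | m
    · simpa using h0
    rcases n with _ | n
    · simpa using h1
    refine mem_idealG_of_X_mul_mem h hp hi.ne' fun v => ?_
    have hXp : (X v * p).IsHomogeneous (1 + i) := (isHomogeneous_X _ v).mul hp
    fin_cases v
    · refine ih hXp (by omega) m (n + 1) ?_ ?_ (by omega)
      · rwa [pow_succ, mul_assoc] at h0
      · rw [mul_left_comm]; exact Ideal.mul_mem_left _ _ h1
    · refine ih hXp (by omega) (m + 1) n ?_ ?_ (by omega)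
      · rw [mul_left_comm]; exact Ideal.mul_mem_left _ _ h0
      · rwa [pow_succ, mul_assoc] at h1

/-- Induction on n: x p and y p satisfy the hypothesis for n − 1, so p is in the socle, and its
degree is below δ unless n = 0. -/
lemma mem_idealG_of_forall_mul_mem (h : IsData f φ d e) {p : B k} {i n : ℕ}
    (hp : p.IsHomogeneous i) (hi : i + n ≤ d - 2)
    (hb : ∀ b : B k, b.IsHomogeneous n → p * b ∈ idealG φ) : p ∈ idealG φ := by
  induction n generalizing p i with
  | zero => simpa using hb 1 (isHomogeneous_one _ _)
  | succ n ih =>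
    refine mem_idealG_of_X_mul_mem h hp (by omega) fun v => ?_
    refine ih ((isHomogeneous_X _ v).mul hp) (by omega) fun b hbn => ?_
    rw [mul_comm (X v), mul_assoc]
    refine hb _ ?_
    rw [add_comm]
    exact (isHomogeneous_X _ v).mul hbn

lemma rho_X (f : Fin 3 → R k) (v : Fin 2) : rho f (X v) = algebraMap (R k) (Sym f) (X v) :=
  aeval_X _ v

lemma rho_mul_eq_zero_iff (h : IsData f φ d e) {b c : B k} :
    rho f b * rho f c = 0 ↔ b * c ∈ idealG φ := by
  rw [← map_mul, rho_eq_zero_iff h]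

/-- `𝒜_i` vanishes for `i > δ`. -/
lemma eq_zero_of_mem_degA (h : IsData f φ d e) {i : ℕ} (hi : d - 2 < i) {a : Sym f}
    (ha : a ∈ degA f i) : a = 0 := by
  obtain ⟨hA, p, hp, rfl⟩ := ha
  change rho f p ∈ idealA f at hA
  have key : ∀ v, ∃ n, X v ^ n * p ∈ idealG φ := by
    intro v
    obtain ⟨n, hn⟩ := h.exists_X_pow_mem v
    obtain ⟨N, hN⟩ := exists_pow_mul_eq_zero hA ⟨_, hn⟩
    refine ⟨n * N, ?_⟩
    rw [← rho_mul_eq_zero_iff h, map_pow, rho_X, pow_mul, ← map_pow]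
    exact hN
  obtain ⟨m, hm⟩ := key 0
  obtain ⟨n, hn⟩ := key 1
  exact (rho_eq_zero_iff h).2 (mem_idealG_of_X_pow_mul_mem h hp hi m n hm hn)

lemma IsSocleGenerator.rho_mem_idealA (h : IsData f φ d e) (hD : IsSocleGenerator φ D) :
    rho f D ∈ idealA f := by
  refine mem_idealA_of_mul_eq_zero (X_ne_zero (0 : Fin 2)) ?_
  rw [← rho_X, rho_mul_eq_zero_iff h]
  exact hD.X_mul_mem 0

lemma smul_rho (f : Fin 3 → R k) (s : S k) (b : B k) : s • rho f b = rho f (C s * b) := by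
  rw [map_mul, rho_C, Algebra.smul_def]

lemma mem_symDeg {a : Sym f} {i : ℕ} :
    a ∈ symDeg f i ↔ ∃ p : B k, p.IsHomogeneous i ∧ rho f p = a := Iff.rfl

/-- Multiplication by x or y sends 𝒜_δ into 𝒜_{δ+1} = 0, so 𝒜_δ lies in the socle. -/
lemma X_mul_mem_idealG_of_mem_degA (h : IsData f φ d e) {p : B k}
    (hp : rho f p ∈ degA f (d - 2)) (v : Fin 2) : X v * p ∈ idealG φ := by
  have hXv : rho f (X v) ∈ symDeg f 1 := mem_symDeg.2 ⟨_, isHomogeneous_X _ v, rfl⟩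
  have hmul : rho f p * rho f (X v) ∈ degA f (d - 2 + 1) := mul_mem_degA f rfl hp hXv
  have h0 := eq_zero_of_mem_degA h (Nat.lt_succ_self _) hmul
  rw [mul_comm]
  exact (rho_mul_eq_zero_iff h).1 h0

/-- `𝒜_δ` is generated by the Sylvester form. -/
lemma IsSocleGenerator.exists_smul_eq (h : IsData f φ d e) (hD : IsSocleGenerator φ D)
    {a : Sym f} (ha : a ∈ degA f (d - 2)) : ∃ s : S k, s • rho f D = a := by
  obtain ⟨p, -, rfl⟩ := mem_symDeg.1 ha.2
  obtain ⟨s, hs⟩ := hD.exists_sub_mem p (X_mul_mem_idealG_of_mem_degA h ha)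
  refine ⟨s, ?_⟩
  rw [← rho_eq_zero_iff h, map_sub, sub_eq_zero] at hs
  rw [smul_rho]
  exact hs.symm

lemma IsSocleGenerator.smul_eq_zero_iff (h : IsData f φ d e) (hD : IsSocleGenerator φ D)
    {s : S k} : s • rho f D = 0 ↔ s = 0 := by
  refine ⟨fun hs => hD.eq_zero s ?_, fun hs => by rw [hs, zero_smul]⟩
  rwa [smul_rho, rho_eq_zero_iff h] at hs

lemma IsSocleGenerator.rho_mem_bidegA (h : IsData f φ d e) (hD : IsSocleGenerator φ D)
    (hDb : D ∈ bidegB k (d - 2) 2) : rho f D ∈ bidegA f (d - 2) 2 :=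
  ⟨hD.rho_mem_idealA h, D, hDb, rfl⟩

attribute [local instance] MvPolynomial.gradedAlgebra in
lemma exists_swap_eq_homogeneousComponent {b : B k} (hb : b ∈ idealG φ) (n : ℕ) :
    ∃ x ∈ idealG φ, swap k x = homogeneousComponent n (swap k b) := by
  refine (Ideal.mem_map_of_equiv (swap k) _).1 ?_
  refine homogeneousComponent_mem_of_mem ?_ (Ideal.mem_map_of_mem (swap k) hb) n
  rw [Ideal.map_span]
  refine Ideal.homogeneous_span _ _ ?_
  rintro _ ⟨_, ⟨m, rfl⟩, rfl⟩
  exact ⟨1, swap_g_isHomogeneous φ m⟩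

/-- `𝒜_(δ,2)` is generated by the Sylvester form. -/
lemma IsSocleGenerator.exists_C_smul_eq (h : IsData f φ d e) (hD : IsSocleGenerator φ D)
    (hDb : D ∈ bidegB k (d - 2) 2) {a : Sym f} (ha : a ∈ bidegA f (d - 2) 2) :
    ∃ c : k, (C c : S k) • rho f D = a := by
  obtain ⟨s, hs⟩ := hD.exists_smul_eq h (bidegA_le_degA f _ _ ha)
  obtain ⟨-, b, hb, hba⟩ := ha
  change rho f b = a at hba
  have hmem : b - C s * D ∈ idealG φ := by
    rw [← rho_eq_zero_iff h, map_sub, hba, ← hs, smul_rho, sub_self]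
  -- Both b and D have T-degree 2, so passing to the component of T-degree 2 replaces s by its
  -- constant term.
  obtain ⟨x, hx, hxs⟩ := exists_swap_eq_homogeneousComponent hmem 2
  have hDs := swap_isHomogeneous hDb.2
  have hxe : x = b - C (C (coeff 0 s)) * D := by
    have hC := swap_map_C (C (coeff 0 s) : R k)
    rw [map_C] at hC
    have hmul : homogeneousComponent 2 (swap k (C s) * swap k D) =
        C (C (coeff 0 s)) * swap k D := by
      rw [mul_comm, homogeneousComponent_add_mul hDs 0, homogeneousComponent_zero,
        commAlgEquiv_C, coeff_map, mul_comm]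
    refine (swap k).injective ?_
    rw [hxs, map_sub, map_sub, homogeneousComponent_eq_self (swap_isHomogeneous hb.2), map_sub,
      map_mul (swap k), map_mul (swap k), hmul, hC]
  rw [hxe, ← rho_eq_zero_iff h, map_sub, hba, sub_eq_zero] at hx
  exact ⟨coeff 0 s, by rw [smul_rho, hx]⟩

end Socle

end MorleyForms

namespace MorleyForms

open MvPolynomial

variable {k : Type*} [Field k] {f : Fin 3 → R k} {φ : Matrix (Fin 3) (Fin 2) (R k)} {d : ℕ}
  {e : Fin 2 → ℕ}

/-! ### Cramer's rule for b ⊗ 1 − 1 ⊗ b -/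

section Diff

noncomputable instance : CommRing (B k ⊗[S k] B k) := Algebra.TensorProduct.instCommRing

lemma diff_add (b c : B k) : diff (b + c) = diff b + diff c := by
  simp only [diff, TensorProduct.add_tmul, TensorProduct.tmul_add]; ring

lemma diff_C (s : S k) : diff (C s : B k) = 0 := by
  have h1 : (C s : B k) = s • 1 := by rw [smul_eq_C_mul, mul_one]
  rw [diff, h1, TensorProduct.smul_tmul, sub_self]

lemma diff_mul (b c : B k) : diff (b * c) = diff b * (c ⊗ₜ 1) + (1 ⊗ₜ b) * diff c := by
  simp only [diff, sub_mul, mul_sub, Algebra.TensorProduct.tmul_mul_tmul, mul_one, one_mul]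
  ring

/-- The ideal of `B ⊗ B` generated by `g₁ ⊗ 1 - 1 ⊗ g₁` and `g₂ ⊗ 1 - 1 ⊗ g₂`. -/
noncomputable abbrev idealDiff (φ : Matrix (Fin 3) (Fin 2) (R k)) : Ideal (B k ⊗[S k] B k) :=
  Ideal.span (Set.range fun m => diff (g φ m))

variable {H : Matrix (Fin 2) (Fin 2) (B k ⊗[S k] B k)}

lemma IsMorleyMatrix.diff_g (hH : IsMorleyMatrix φ H) (m : Fin 2) :
    diff (g φ m) = diff (X 0) * H 0 m + diff (X 1) * H 1 m := by
  have := congrFun hH m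
  simpa [Matrix.vecMul, dotProduct, Fin.sum_univ_two] using this

/-- For b = x, y this is multiplication by the adjugate of H; the twisted Leibniz rule `diff_mul`
propagates it to all b. It says that b ⊗ 1 and 1 ⊗ b act alike on Δ. -/
lemma IsMorleyMatrix.diff_mul_det_mem (hH : IsMorleyMatrix φ H) (b : B k) :
    diff b * H.det ∈ idealDiff φ := by
  have hg : ∀ m, diff (g φ m) ∈ idealDiff φ := fun m => Ideal.subset_span ⟨m, rfl⟩
  induction b using MvPolynomial.induction_on with
  | C s => rw [diff_C, zero_mul]; exact zero_mem _
  | add p q hp hq => rw [diff_add, add_mul]; exact add_mem hp hq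
  | mul_X p v hp =>
    rw [diff_mul, add_mul, mul_right_comm, mul_assoc (1 ⊗ₜ[S k] p)]
    refine add_mem (Ideal.mul_mem_right _ _ hp) (Ideal.mul_mem_left _ _ ?_)
    fin_cases v
    · convert sub_mem (Ideal.mul_mem_left _ (H 1 1) (hg 0))
        (Ideal.mul_mem_left _ (H 1 0) (hg 1)) using 1
      rw [hH.diff_g, hH.diff_g, Matrix.det_fin_two, Fin.zero_eta]; ring
    · convert sub_mem (Ideal.mul_mem_left _ (H 0 0) (hg 1))
        (Ideal.mul_mem_left _ (H 0 1) (hg 0)) using 1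
      rw [hH.diff_g, hH.diff_g, Matrix.det_fin_two, Fin.mk_one]; ring

end Diff

/-! ### Contracting Δ against functionals -/

section Contract

/-- `(b ⊗ c) ↦ ρ ((U c • b)_i)`. -/
noncomputable def contractDeg (f : Fin 3 → R k) (i : ℕ) (U : B k →ₗ[S k] S k) :
    B k ⊗[S k] B k →ₗ[S k] Sym f :=
  (rho f).toLinearMap ∘ₗ homogeneousComponent i ∘ₗ
    (TensorProduct.rid (S k) (B k)).toLinearMap ∘ₗ U.lTensor (B k)

lemma contractDeg_tmul (f : Fin 3 → R k) (i : ℕ) (U : B k →ₗ[S k] S k) (b c : B k) :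
    contractDeg f i U (b ⊗ₜ c) = U c • rho f (homogeneousComponent i b) := by
  simp [contractDeg]

lemma contract_eq_contractDeg (f : Fin 3 → R k) (H : Matrix (Fin 2) (Fin 2) (B k ⊗[S k] B k))
    (i j : ℕ) (u : symDeg f j →ₗ[S k] S k) :
    contract f H i j u = contractDeg f i (u ∘ₗ rhoDeg f j) H.det := by
  rw [contract_apply, morl]
  induction H.det using TensorProduct.induction_on with
  | zero => simp
  | tmul b c =>
    rw [contractDeg_tmul, TensorProduct.map_tmul, LinearMap.lTensor_tmul, TensorProduct.rid_tmul]
    rfl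
  | add x y hx hy =>
    rw [map_add, map_add, map_add, Submodule.coe_add, hx, hy, map_add]

lemma rho_homogeneousComponent_g_mul (h : IsData f φ d e) (i : ℕ) (m : Fin 2) (b : B k) :
    rho f (homogeneousComponent i (g φ m * b)) = 0 :=
  (rho_eq_zero_iff h).2
    (h.homogeneousComponent_mem (Ideal.mul_mem_right _ _ (g_mem_idealG φ m)) i)

lemma contractDeg_eq_zero (h : IsData f φ d e) (i j : ℕ) (u : symDeg f j →ₗ[S k] S k)
    {z : B k ⊗[S k] B k} (hz : z ∈ idealDiff φ) :
    contractDeg f i (u ∘ₗ rhoDeg f j) z = 0 := by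
  have key : ∀ m (w : B k ⊗[S k] B k),
      contractDeg f i (u ∘ₗ rhoDeg f j) (w * diff (g φ m)) = 0 := by
    intro m w
    induction w using TensorProduct.induction_on with
    | zero => rw [zero_mul, map_zero]
    | tmul b c =>
      have hr : rhoDeg f j (g φ m * c) = 0 :=
        Subtype.ext (rho_homogeneousComponent_g_mul h j m c)
      rw [mul_comm, diff, sub_mul, Algebra.TensorProduct.tmul_mul_tmul,
        Algebra.TensorProduct.tmul_mul_tmul, map_sub, contractDeg_tmul, contractDeg_tmul,
        rho_homogeneousComponent_g_mul h, smul_zero, LinearMap.comp_apply, hr, map_zero,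
        zero_smul, sub_zero]
    | add x y hx hy => rw [add_mul, map_add, hx, hy, add_zero]
  induction hz using Submodule.span_induction with
  | mem z hz =>
    obtain ⟨m, rfl⟩ := hz
    simpa using key m 1
  | zero => rw [map_zero]
  | add x y _ _ hx hy => rw [map_add, hx, hy, add_zero]
  | smul r x hx _ =>
    -- Contraction is only S-linear, so vanishing at x does not give vanishing at r x; the induction
    -- is rerun with r universally quantified.
    have : ∀ x ∈ idealDiff φ, ∀ r, contractDeg f i (u ∘ₗ rhoDeg f j) (r * x) = 0 := by
      intro x hx
      induction hx using Submodule.span_induction with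
      | mem z hz =>
        obtain ⟨m, rfl⟩ := hz
        exact key m
      | zero => intro r; rw [mul_zero, map_zero]
      | add x y _ _ hx hy => intro r; rw [mul_add, map_add, hx, hy, add_zero]
      | smul s x _ hx => intro r; rw [smul_eq_mul, ← mul_assoc]; exact hx _
    exact this x hx r

lemma rho_mul_contractDeg {b : B k} {n : ℕ} (hb : b.IsHomogeneous n) (i : ℕ)
    (U : B k →ₗ[S k] S k) (z : B k ⊗[S k] B k) :
    rho f b * contractDeg f i U z = contractDeg f (n + i) U ((b ⊗ₜ 1) * z) := by
  induction z using TensorProduct.induction_on with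
  | zero => rw [mul_zero, map_zero, map_zero, mul_zero]
  | tmul c c' =>
    rw [Algebra.TensorProduct.tmul_mul_tmul, contractDeg_tmul, contractDeg_tmul, one_mul,
      homogeneousComponent_add_mul hb, map_mul, mul_smul_comm]
  | add x y hx hy => rw [map_add, mul_add, hx, hy, mul_add, map_add]

lemma contractDeg_one_tmul_mul (i : ℕ) (U : B k →ₗ[S k] S k) (b : B k) (z : B k ⊗[S k] B k) :
    contractDeg f i U ((1 ⊗ₜ b) * z) = contractDeg f i (U ∘ₗ LinearMap.mulLeft (S k) b) z := by
  induction z using TensorProduct.induction_on with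
  | zero => rw [map_zero, mul_zero, map_zero]
  | tmul c c' =>
    rw [Algebra.TensorProduct.tmul_mul_tmul, contractDeg_tmul, contractDeg_tmul, one_mul]
    rfl
  | add x y hx hy => rw [map_add, mul_add, map_add, hx, hy]

variable {H : Matrix (Fin 2) (Fin 2) (B k ⊗[S k] B k)}

/-- `(b ⊗ 1) Δ = (1 ⊗ b) Δ`, contracted against a functional. -/
lemma rho_mul_contract (h : IsData f φ d e) (hH : IsMorleyMatrix φ H) {b : B k} {n : ℕ}
    (hb : b.IsHomogeneous n) (i j : ℕ) (u : symDeg f j →ₗ[S k] S k) :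
    rho f b * contract f H i j u =
      contractDeg f (n + i) (u ∘ₗ rhoDeg f j ∘ₗ LinearMap.mulLeft (S k) b) H.det := by
  have hsplit : (b ⊗ₜ 1 : B k ⊗[S k] B k) = diff b + 1 ⊗ₜ b := by rw [diff, sub_add_cancel]
  rw [contract_eq_contractDeg, rho_mul_contractDeg hb, hsplit, add_mul, map_add,
    contractDeg_eq_zero h _ _ _ (hH.diff_mul_det_mem b), zero_add, contractDeg_one_tmul_mul]
  rfl

/-- Once b is moved to the second factor, every product there has order at least n > j, so u sees
nothing. -/
lemma rho_mul_contract_eq_zero (h : IsData f φ d e) (hH : IsMorleyMatrix φ H) {b : B k} {n : ℕ}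
    (hb : b.IsHomogeneous n) (i : ℕ) {j : ℕ} (hj : j < n) (u : symDeg f j →ₗ[S k] S k) :
    rho f b * contract f H i j u = 0 := by
  have h0 : rhoDeg f j ∘ₗ LinearMap.mulLeft (S k) b = 0 := by
    refine LinearMap.ext fun c => Subtype.ext ?_
    change rho f (homogeneousComponent j (b * c)) = 0
    rw [homogeneousComponent_mul_of_lt hb hj, map_zero]
  rw [rho_mul_contract h hH hb, h0, LinearMap.comp_zero]
  simp [contractDeg]

/-- Evaluation of the second tensor factor at the origin. -/
noncomputable def evalRight (k : Type*) [Field k] : B k ⊗[S k] B k →ₐ[S k] B k :=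
  Algebra.TensorProduct.lift (AlgHom.id (S k) (B k)) (aeval fun _ => 0) fun _ _ => Commute.all _ _

lemma evalRight_tmul (b c : B k) : evalRight k (b ⊗ₜ c) = b * C (constantCoeff c) := by
  simp only [evalRight, Algebra.TensorProduct.lift_tmul, AlgHom.id_apply]
  congr 1
  exact aeval_zero' c

lemma evalRight_diff (b : B k) : evalRight k (diff b) = b - C (constantCoeff b) := by
  rw [diff, map_sub, evalRight_tmul, evalRight_tmul, map_one, C_1, mul_one, one_mul]

/-- As b already has degree j, the degree j part of b c' involves only the constant term of c'. -/
lemma contractDeg_eq_smul_evalRight {b : B k} {j : ℕ} (hb : b.IsHomogeneous j) (i : ℕ)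
    (u : symDeg f j →ₗ[S k] S k) (z : B k ⊗[S k] B k) :
    contractDeg f i (u ∘ₗ rhoDeg f j ∘ₗ LinearMap.mulLeft (S k) b) z =
      u ⟨rho f b, b, hb, rfl⟩ • rho f (homogeneousComponent i (evalRight k z)) := by
  induction z using TensorProduct.induction_on with
  | zero => simp only [map_zero, smul_zero]
  | tmul c c' =>
    have h0 : rhoDeg f j (b * c') = constantCoeff c' • ⟨rho f b, b, hb, rfl⟩ := by
      refine Subtype.ext ?_
      change rho f (homogeneousComponent (j + 0) (b * c')) = constantCoeff c' • rho f b
      rw [homogeneousComponent_add_mul hb, homogeneousComponent_zero, smul_rho, mul_comm]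
      rfl
    rw [contractDeg_tmul, evalRight_tmul, LinearMap.comp_apply, LinearMap.comp_apply,
      LinearMap.mulLeft_apply, h0, map_smul, smul_eq_mul, mul_comm c, homogeneousComponent_C_mul,
      ← smul_rho, smul_smul, mul_comm]
  | add x y hx hy => rw [map_add, hx, hy, map_add, map_add, map_add, smul_add]

/-- The duality formula: the factor multiplying u(b) depends neither on u nor on b. -/
lemma mul_contract (h : IsData f φ d e) (hH : IsMorleyMatrix φ H) (i j : ℕ)
    (u : symDeg f j →ₗ[S k] S k) (b : symDeg f j) :
    b * contract f H i j u =
      u b • rho f (homogeneousComponent (j + i) (evalRight k H.det)) := by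
  obtain ⟨_, b, hb, rfl⟩ := b
  exact (rho_mul_contract h hH hb i j u).trans (contractDeg_eq_smul_evalRight hb _ _ _)

lemma contract_mem_degA (h : IsData f φ d e) (hH : IsMorleyMatrix φ H) (i j : ℕ)
    (u : symDeg f j →ₗ[S k] S k) : contract f H i j u ∈ degA f i := by
  refine ⟨?_, Subtype.coe_prop _⟩
  refine mem_idealA_of_mul_eq_zero (pow_ne_zero (j + 1) (X_ne_zero (0 : Fin 2))) ?_
  rw [map_pow, ← rho_X, ← map_pow]
  exact rho_mul_contract_eq_zero h hH (isHomogeneous_X_pow 0 (j + 1)) i (Nat.lt_succ_self j) u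

/-- Setting the second copy of x, y to zero turns the defining identity of H into g_m = x P_m + y
Q_m, and det H into the corresponding Sylvester form. -/
lemma isSocleGenerator_evalRight_det (h : IsData f φ d e) (hH : IsMorleyMatrix φ H) :
    IsSocleGenerator φ (evalRight k H.det) := by
  have hPQ : ∀ m, g φ m = X 0 * evalRight k (H 0 m) + X 1 * evalRight k (H 1 m) := by
    intro m
    have := congrArg (evalRight k) (hH.diff_g m)
    rw [map_add, map_mul, map_mul, evalRight_diff, evalRight_diff, evalRight_diff,
      (h.g_isHomogeneous m).constantCoeff_eq_zero (h.e_pos m)] at this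
    simpa using this
  have := h.isSocleGenerator hPQ
  rw [Matrix.det_fin_two, map_sub, map_mul, map_mul]
  exact this

lemma exists_rho_homogeneousComponent_evalRight (h : IsData f φ d e) (hH : IsMorleyMatrix φ H)
    {D : B k} (hD : IsSocleGenerator φ D) (hDb : D.IsHomogeneous (d - 2)) :
    ∃ c : kˣ, rho f (homogeneousComponent (d - 2) (evalRight k H.det)) =
      (C (c : k) : S k) • rho f D := by
  obtain ⟨c, hc⟩ := hD.exists_unit (isSocleGenerator_evalRight_det h hH)
  refine ⟨c, ?_⟩
  have := (rho_eq_zero_iff h).2 (h.homogeneousComponent_mem hc (d - 2))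
  rwa [map_sub, homogeneousComponent_C_mul, homogeneousComponent_eq_self hDb, map_sub, sub_eq_zero,
    ← smul_rho] at this

end Contract

end MorleyForms

namespace MorleyForms

open MvPolynomial

variable {k : Type*} [Field k] {f : Fin 3 → R k} {φ : Matrix (Fin 3) (Fin 2) (R k)} {d : ℕ}
  {e : Fin 2 → ℕ}

/-! ### Total (x, y)-degree on B ⊗ B -/

section TotalDegree

/-- The component of total `(x, y)`-degree `n` in `B ⊗ B`. -/
noncomputable def totalComponent (k : Type*) [Field k] (n : ℕ) :
    B k ⊗[S k] B k →ₗ[S k] B k ⊗[S k] B k :=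
  ∑ p ∈ Finset.HasAntidiagonal.antidiagonal n,
    TensorProduct.map (homogeneousComponent p.1) (homogeneousComponent p.2)

lemma totalComponent_tmul {b c : B k} {i j : ℕ} (hb : b.IsHomogeneous i) (hc : c.IsHomogeneous j)
    (n : ℕ) : totalComponent k n (b ⊗ₜ c) = if i + j = n then b ⊗ₜ c else 0 := by
  simp only [totalComponent, LinearMap.sum_apply, TensorProduct.map_tmul]
  split_ifs with hn
  · rw [Finset.sum_eq_single (i, j)]
    · rw [homogeneousComponent_eq_self hb, homogeneousComponent_eq_self hc]
    · rintro ⟨i', j'⟩ hp hne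
      rw [Finset.HasAntidiagonal.mem_antidiagonal] at hp
      dsimp only at hp ⊢
      rw [homogeneousComponent_of_mem hb, if_neg, TensorProduct.zero_tmul]
      rintro rfl
      exact hne (Prod.ext rfl (by omega))
    · exact fun hp => absurd (Finset.HasAntidiagonal.mem_antidiagonal.2 hn) hp
  · refine Finset.sum_eq_zero fun p hp => ?_
    rw [Finset.HasAntidiagonal.mem_antidiagonal] at hp
    rw [homogeneousComponent_of_mem hb, homogeneousComponent_of_mem hc]
    split_ifs
    · omega
    · rw [TensorProduct.tmul_zero]
    · rw [TensorProduct.zero_tmul]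
    · rw [TensorProduct.zero_tmul]

lemma tensor_induction_on_isHomogeneous {p : B k ⊗[S k] B k → Prop} (z : B k ⊗[S k] B k)
    (zero : p 0)
    (tmul : ∀ i j (b c : B k), b.IsHomogeneous i → c.IsHomogeneous j → p (b ⊗ₜ c))
    (add : ∀ x y, p x → p y → p (x + y)) : p z := by
  induction z using TensorProduct.induction_on with
  | zero => exact zero
  | add x y hx hy => exact add x y hx hy
  | tmul b c =>
    induction b using induction_on_isHomogeneous with
    | add a b ha hb => rw [TensorProduct.add_tmul]; exact add _ _ ha hb
    | h n b hb =>
      induction c using induction_on_isHomogeneous with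
      | add a b ha hb => rw [TensorProduct.tmul_add]; exact add _ _ ha hb
      | h m c hc => exact tmul n m b c hb hc

lemma totalComponent_mul_mul (a b : ℕ) (z w : B k ⊗[S k] B k) :
    totalComponent k (a + b) (totalComponent k a z * totalComponent k b w) =
      totalComponent k a z * totalComponent k b w := by
  induction z using tensor_induction_on_isHomogeneous with
  | zero => simp only [map_zero, zero_mul]
  | add x y hx hy => rw [map_add, add_mul, map_add, hx, hy]
  | tmul i j c c' hc hc' =>
    induction w using tensor_induction_on_isHomogeneous with
    | zero => simp only [map_zero, mul_zero]
    | add x y hx hy => rw [map_add, mul_add, map_add, hx, hy]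
    | tmul i' j' x x' hx hx' =>
      rw [totalComponent_tmul hc hc', totalComponent_tmul hx hx']
      split_ifs
      · rw [Algebra.TensorProduct.tmul_mul_tmul, totalComponent_tmul (hc.mul hx) (hc'.mul hx'),
          if_pos (by omega)]
      all_goals simp only [mul_zero, zero_mul, map_zero]

lemma totalComponent_diff_mul {b : B k} {p : ℕ} (hb : b.IsHomogeneous p) (n : ℕ)
    (z : B k ⊗[S k] B k) :
    totalComponent k (p + n) (diff b * z) = diff b * totalComponent k n z := by
  induction z using tensor_induction_on_isHomogeneous with
  | zero => simp only [map_zero, mul_zero]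
  | add x y hx hy => rw [map_add, mul_add, map_add, hx, hy, mul_add]
  | tmul i j c c' hc hc' =>
    rw [totalComponent_tmul hc hc', diff, sub_mul, Algebra.TensorProduct.tmul_mul_tmul,
      Algebra.TensorProduct.tmul_mul_tmul, one_mul, one_mul, map_sub,
      totalComponent_tmul (hb.mul hc) hc', totalComponent_tmul hc (hb.mul hc')]
    by_cases hn : i + j = n
    · rw [if_pos hn, if_pos (by omega), if_pos (by omega), sub_mul,
        Algebra.TensorProduct.tmul_mul_tmul, Algebra.TensorProduct.tmul_mul_tmul, one_mul, one_mul]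
    · rw [if_neg hn, if_neg (by omega), if_neg (by omega), sub_self, mul_zero]

lemma totalComponent_diff_mul_of_lt {b : B k} {p n : ℕ} (hb : b.IsHomogeneous p) (hn : n < p)
    (z : B k ⊗[S k] B k) : totalComponent k n (diff b * z) = 0 := by
  induction z using tensor_induction_on_isHomogeneous with
  | zero => simp only [map_zero, mul_zero]
  | add x y hx hy => rw [mul_add, map_add, hx, hy, add_zero]
  | tmul i j c c' hc hc' =>
    rw [diff, sub_mul, Algebra.TensorProduct.tmul_mul_tmul,
      Algebra.TensorProduct.tmul_mul_tmul, one_mul, one_mul, map_sub,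
      totalComponent_tmul (hb.mul hc) hc', totalComponent_tmul hc (hb.mul hc'),
      if_neg (by omega), if_neg (by omega), sub_self]

lemma totalComponent_diff {b : B k} {n : ℕ} (hb : b.IsHomogeneous n) :
    totalComponent k n (diff b) = diff b := by
  rw [diff, map_sub, totalComponent_tmul hb (isHomogeneous_one _ _),
    totalComponent_tmul (isHomogeneous_one _ _) hb, if_pos (by omega), if_pos (by omega)]

end TotalDegree

/-! ### Koszul relations between x ⊗ 1 − 1 ⊗ x and y ⊗ 1 − 1 ⊗ y -/

section Koszul

/-- `b ⊗ c ↦ b c(x - X, y - Y)`. -/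
noncomputable def diffCoord (k : Type*) [Field k] :
    B k ⊗[S k] B k →ₐ[S k] MvPolynomial (Fin 2) (B k) :=
  Algebra.TensorProduct.lift (Algebra.algHom (S k) (B k) (MvPolynomial (Fin 2) (B k)))
    (aeval fun v => C (X v) - X v) fun _ _ => Commute.all _ _

/-- Left inverse of `diffCoord`. -/
noncomputable def diffCoordInv (k : Type*) [Field k] :
    MvPolynomial (Fin 2) (B k) →ₐ[B k] B k ⊗[S k] B k :=
  aeval fun v => diff (X v)

lemma diffCoord_diff_X (v : Fin 2) : diffCoord k (diff (X v)) = X v := by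
  rw [diff, map_sub, diffCoord, Algebra.TensorProduct.lift_tmul, Algebra.TensorProduct.lift_tmul,
    map_one, map_one, mul_one, one_mul, aeval_X]
  exact sub_sub_cancel (C (X v) : MvPolynomial (Fin 2) (B k)) (X v)

lemma diffCoordInv_diffCoord (z : B k ⊗[S k] B k) : diffCoordInv k (diffCoord k z) = z := by
  have hl : ∀ b : B k, diffCoordInv k (C b) = b ⊗ₜ 1 := fun b => aeval_C _ b
  have : ((diffCoordInv k).restrictScalars (S k)).comp (diffCoord k) = AlgHom.id _ _ := by
    refine Algebra.TensorProduct.ext ?_ ?_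
    · refine AlgHom.ext fun b => ?_
      change diffCoordInv k (diffCoord k (b ⊗ₜ 1)) = b ⊗ₜ 1
      rw [diffCoord, Algebra.TensorProduct.lift_tmul, map_one, mul_one]
      exact hl b
    · refine MvPolynomial.algHom_ext fun v => ?_
      change diffCoordInv k (diffCoord k (1 ⊗ₜ X v)) = 1 ⊗ₜ X v
      rw [diffCoord, Algebra.TensorProduct.lift_tmul, map_one, one_mul, aeval_X, map_sub, hl,
        diffCoordInv, aeval_X, diff, sub_sub_cancel]
  exact AlgHom.congr_fun this z

/-- In the coordinates of `diffCoord` the two differences become polynomial variables over B, where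
the only relations are Koszul; the left inverse brings the cofactor back. -/
lemma exists_eq_diff_mul {p q : B k ⊗[S k] B k} (h : diff (X 0) * p + diff (X 1) * q = 0) :
    ∃ t, p = diff (X 1) * t ∧ q = -(diff (X 0) * t) := by
  have h1 := congrArg (diffCoord k) h
  rw [map_add, map_mul, map_mul, map_zero, diffCoord_diff_X, diffCoord_diff_X] at h1
  obtain ⟨r, hr, hr'⟩ := dvd_of_X_mul_eq_X_mul (i := (0 : Fin 2)) (j := 1) (by decide)
    (a := diffCoord k p) (b := -diffCoord k q) (by linear_combination h1)
  have hX : ∀ v, diffCoordInv k (X v) = diff (X v) := fun v => aeval_X _ v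
  refine ⟨diffCoordInv k r, ?_, ?_⟩
  · rw [← diffCoordInv_diffCoord p, hr, map_mul, hX]
  · rw [← diffCoordInv_diffCoord q, ← hX, ← map_mul, ← hr', map_neg, neg_neg]

end Koszul

/-! ### Homogeneity of Δ -/

variable {H : Matrix (Fin 2) (Fin 2) (B k ⊗[S k] B k)}

/-- A matrix of Morley type is determined up to Koszul relations, so that it may be replaced by
its part of the expected degree without changing `Δ`. -/
lemma IsMorleyMatrix.exists_det_eq (h : IsData f φ d e) (hH : IsMorleyMatrix φ H) :
    ∃ z t₀ t₁ : B k ⊗[S k] B k, totalComponent k (d - 2) z = z ∧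
      H.det = z + diff (g φ 1) * t₀ - diff (g φ 0) * t₁ := by
  set H' : Fin 2 → Fin 2 → B k ⊗[S k] B k := fun v m => totalComponent k (e m - 1) (H v m)
  have hdiff : ∀ m, diff (g φ m) = diff (X 0) * H' 0 m + diff (X 1) * H' 1 m := by
    intro m
    have hm : e m = 1 + (e m - 1) := by have := h.e_pos m; omega
    rw [← totalComponent_diff (h.g_isHomogeneous m), hH.diff_g, hm, map_add,
      totalComponent_diff_mul (isHomogeneous_X _ 0), totalComponent_diff_mul (isHomogeneous_X _ 1)]
  -- Both matrices solve the same equation, so their columns differ by Koszul relations. In the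
  -- determinant the terms linear in t are multiples of the `diff (g φ m)`, and the quadratic term
  -- cancels.
  have ht : ∀ m, ∃ t, H 0 m - H' 0 m = diff (X 1) * t ∧ H 1 m - H' 1 m = -(diff (X 0) * t) :=
    fun m => exists_eq_diff_mul (by linear_combination hdiff m - hH.diff_g m)
  choose t ht₀ ht₁ using ht
  have hd : d - 2 = e 0 - 1 + (e 1 - 1) := by
    have := h.e_add_e
    have := h.e_pos 0
    have := h.e_pos 1
    omega
  refine ⟨H' 0 0 * H' 1 1 - H' 1 0 * H' 0 1, t 0, t 1, ?_, ?_⟩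
  · rw [hd, map_sub, totalComponent_mul_mul, totalComponent_mul_mul]
  · rw [Matrix.det_fin_two, hdiff, hdiff, sub_eq_iff_eq_add.1 (ht₀ 0), sub_eq_iff_eq_add.1 (ht₀ 1),
      sub_eq_iff_eq_add.1 (ht₁ 0), sub_eq_iff_eq_add.1 (ht₁ 1)]
    ring

lemma map_rho_diff_g_mul (h : IsData f φ d e) (m : Fin 2) (z : B k ⊗[S k] B k) :
    Algebra.TensorProduct.map (rho f) (rho f) (diff (g φ m) * z) = 0 := by
  rw [map_mul, diff, map_sub, Algebra.TensorProduct.map_tmul, Algebra.TensorProduct.map_tmul,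
    rho_g h, TensorProduct.zero_tmul, TensorProduct.tmul_zero, sub_self, zero_mul]

lemma map_rho_totalComponent_diff_g_mul (h : IsData f φ d e) (m : Fin 2) (n : ℕ)
    (z : B k ⊗[S k] B k) :
    Algebra.TensorProduct.map (rho f) (rho f) (totalComponent k n (diff (g φ m) * z)) = 0 := by
  rcases lt_or_ge n (e m) with hn | hn
  · rw [totalComponent_diff_mul_of_lt (h.g_isHomogeneous m) hn, map_zero]
  · rw [← Nat.add_sub_of_le hn, totalComponent_diff_mul (h.g_isHomogeneous m),
      map_rho_diff_g_mul h]

lemma incl_morl (f : Fin 3 → R k) (H : Matrix (Fin 2) (Fin 2) (B k ⊗[S k] B k)) (i j : ℕ) :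
    incl f i j (morl f H i j) = Algebra.TensorProduct.map (rho f) (rho f)
      (TensorProduct.map (homogeneousComponent i) (homogeneousComponent j) H.det) := by
  rw [incl, morl]
  induction H.det using TensorProduct.induction_on with
  | zero => simp only [map_zero]
  | tmul b c => rfl
  | add x y hx hy => simp only [map_add, hx, hy]

/-- `Δ` is the sum of the Morley forms of total degree `δ`. -/
lemma Delta_eq_sum_incl_morl (h : IsData f φ d e) (hH : IsMorleyMatrix φ H) :
    Delta f H = ∑ p ∈ Finset.HasAntidiagonal.antidiagonal (d - 2),
      incl f p.1 p.2 (morl f H p.1 p.2) := by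
  have hsum : ∑ p ∈ Finset.HasAntidiagonal.antidiagonal (d - 2),
      incl f p.1 p.2 (morl f H p.1 p.2) =
      Algebra.TensorProduct.map (rho f) (rho f) (totalComponent k (d - 2) H.det) := by
    rw [totalComponent, LinearMap.sum_apply, map_sum]
    exact Finset.sum_congr rfl fun p _ => incl_morl f H p.1 p.2
  obtain ⟨z, t₀, t₁, hz, hdet⟩ := hH.exists_det_eq h
  rw [hsum, Delta, hdet, map_sub, map_add, map_sub, map_add, hz, map_sub, map_add,
    map_rho_diff_g_mul h, map_rho_diff_g_mul h, map_rho_totalComponent_diff_g_mul h,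
    map_rho_totalComponent_diff_g_mul h]

/-! ### The duality between 𝒜_i and Sym(I)_{δ−i} -/

lemma bijective_muSyl (h : IsData f φ d e) {D : B k} (hD : IsSocleGenerator φ D) {c : k}
    (hc : c ≠ 0) {syl : degA f (d - 2)} (hsyl : (C c : S k) • rho f D = syl) :
    Function.Bijective (muSyl f syl) := by
  have hs : ∀ s : S k, (muSyl f syl s : Sym f) = (s * C c) • rho f D := fun s => by
    rw [mul_smul, hsyl]; rfl
  constructor
  · rw [injective_iff_map_eq_zero]
    intro s h0
    have h1 := hs s
    rw [h0] at h1
    have h2 := (hD.smul_eq_zero_iff h).1 h1.symm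
    exact (mul_eq_zero.1 h2).resolve_right (by simpa using hc)
  · intro a
    obtain ⟨s, hsa⟩ := hD.exists_smul_eq h a.2
    refine ⟨s * C c⁻¹, Subtype.ext ?_⟩
    rw [hs, mul_assoc, ← C_mul, inv_mul_cancel₀ hc, C_1, mul_one, hsa]

/-- Multiplication `𝒜_i × Sym(I)_j → 𝒜_δ` is non-degenerate in the first factor. -/
lemma eq_zero_of_forall_mul_eq_zero (h : IsData f φ d e) {i j : ℕ} (hij : i + j = d - 2)
    {a : Sym f} (ha : a ∈ symDeg f i) (hab : ∀ b ∈ symDeg f j, a * b = 0) : a = 0 := by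
  obtain ⟨p, hp, rfl⟩ := mem_symDeg.1 ha
  refine (rho_eq_zero_iff h).2 (mem_idealG_of_forall_mul_mem h hp hij.le fun b hb => ?_)
  exact (rho_mul_eq_zero_iff h).1 (hab _ (mem_symDeg.2 ⟨b, hb, rfl⟩))

lemma nu2_smul_eq {i j n : ℕ} (hij : i + j = n) (syl : degA f n)
    (hsyl : Function.Bijective (muSyl f syl)) (a : degA f i) (b : symDeg f j) :
    nu2 f hij syl hsyl a b • (syl : Sym f) = (a : Sym f) * (b : Sym f) := by
  have h1 : muSyl f syl (nu2 f hij syl hsyl a b) = mulA f hij a b :=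
    (LinearEquiv.ofBijective (muSyl f syl) hsyl).apply_symm_apply _
  exact congrArg Subtype.val h1

lemma nu2_eq_iff {i j n : ℕ} (hij : i + j = n) (syl : degA f n)
    (hsyl : Function.Bijective (muSyl f syl)) (a : degA f i) (b : symDeg f j) (s : S k) :
    nu2 f hij syl hsyl a b = s ↔ (a : Sym f) * (b : Sym f) = s • (syl : Sym f) := by
  rw [← nu2_smul_eq hij syl hsyl a b]
  refine ⟨fun hs => by rw [hs], fun hs => hsyl.1 (Subtype.ext hs)⟩

lemma nu2_nu1 (h : IsData f φ d e) (hH : IsMorleyMatrix φ H) {i j : ℕ} (hij : i + j = d - 2)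
    (h1 : ∀ u, contract f H i j u ∈ degA f i) (syl : degA f (d - 2))
    (hsyl : Function.Bijective (muSyl f syl)) {s : S k}
    (hs : rho f (homogeneousComponent (d - 2) (evalRight k H.det)) = s • (syl : Sym f))
    (u : symDeg f j →ₗ[S k] S k) :
    nu2 f hij syl hsyl (nu1 f H i j h1 u) = s • u := by
  refine LinearMap.ext fun b => (nu2_eq_iff _ _ _ _ _ _).2 ?_
  change contract f H i j u * b = (s * u b) • (syl : Sym f)
  rw [mul_comm, mul_contract h hH, add_comm j, hij, hs, smul_smul, mul_comm s]

lemma nu2_injective (h : IsData f φ d e) {i j : ℕ} (hij : i + j = d - 2) (syl : degA f (d - 2))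
    (hsyl : Function.Bijective (muSyl f syl)) : Function.Injective (nu2 f hij syl hsyl) := by
  rw [injective_iff_map_eq_zero]
  intro a ha
  refine Subtype.ext (eq_zero_of_forall_mul_eq_zero h hij a.2.2 fun b hb => ?_)
  rw [← zero_smul (S k) (syl : Sym f), ← nu2_eq_iff hij syl hsyl a ⟨b, hb⟩ 0, ha]
  rfl

end MorleyForms

theorem theorem4p2 {k : Type*} [Field k] (f : Fin 3 → MorleyForms.R k)
    (φ : Matrix (Fin 3) (Fin 2) (MorleyForms.R k)) (d : ℕ) (e : Fin 2 → ℕ)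
    (hdata : IsData f φ d e)
    (H : Matrix (Fin 2) (Fin 2) (MorleyForms.B k ⊗[MorleyForms.S k] MorleyForms.B k))
    (hH : IsMorleyMatrix φ H) :
    -- the Morley forms are the components of `Δ`
    Delta f H = ∑ p ∈ Finset.HasAntidiagonal.antidiagonal (d - 2), incl f p.1 p.2 (morl f H p.1 p.2) ∧
    -- the space containing the Sylvester form is one-dimensional
    Module.finrank k (bidegA f (d - 2) 2) = 1 ∧
    -- contraction of a Morley form lands in `𝒜_i`
    ∃ h1 : ∀ i j : ℕ, i + j = d - 2 → ∀ u, contract f H i j u ∈ degA f i,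
    -- for any choice of `syl`, the maps `ν₁` and `ν₂` are inverse up to a unit of `k`
    ∀ (syl : Sym f) (hsyl : syl ∈ bidegA f (d - 2) 2), syl ≠ 0 →
    ∃ h2 : Function.Bijective (muSyl f ⟨syl, bidegA_le_degA f (d - 2) 2 hsyl⟩),
    ∃ α : kˣ, ∀ (i j : ℕ) (hij : i + j = d - 2),
      (∀ u : symDeg f j →ₗ[MorleyForms.S k] MorleyForms.S k,
        nu2 f hij ⟨syl, bidegA_le_degA f (d - 2) 2 hsyl⟩ h2 (nu1 f H i j (h1 i j hij) u) =
          (MvPolynomial.C (α : k) : MorleyForms.S k) • u) ∧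
      (∀ a : degA f i,
        nu1 f H i j (h1 i j hij) (nu2 f hij ⟨syl, bidegA_le_degA f (d - 2) 2 hsyl⟩ h2 a) =
          (MvPolynomial.C (α : k) : MorleyForms.S k) • a) := by
  obtain ⟨D, hDb, hD⟩ := hdata.exists_bihomogeneous_isSocleGenerator
  have hsmul : ∀ (c : k) (a : Sym f), c • a = (MvPolynomial.C c : MorleyForms.S k) • a :=
    fun c a => (algebraMap_smul (MorleyForms.S k) c a).symm
  refine ⟨Delta_eq_sum_incl_morl hdata hH, ?_, fun i j _ u => contract_mem_degA hdata hH i j u,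
    fun syl hsyl hne => ?_⟩
  · refine (finrank_eq_one_iff_of_nonzero' (⟨rho f D, hD.rho_mem_bidegA hdata hDb⟩ :
      bidegA f (d - 2) 2) fun h0 => ?_).2 fun a => ?_
    · have h1 : (1 : MorleyForms.S k) • rho f D = 0 := by
        rw [one_smul]; exact congrArg Subtype.val h0
      exact one_ne_zero ((hD.smul_eq_zero_iff hdata).1 h1)
    · obtain ⟨c, hc⟩ := hD.exists_C_smul_eq hdata hDb a.2
      exact ⟨c, Subtype.ext ((hsmul c _).trans hc)⟩
  · obtain ⟨c, hc⟩ := hD.exists_C_smul_eq hdata hDb hsyl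
    have hc0 : c ≠ 0 := by
      rintro rfl
      exact hne (by rw [← hc, MvPolynomial.C_0, zero_smul])
    obtain ⟨c', hc'⟩ := exists_rho_homogeneousComponent_evalRight hdata hH hD hDb.1
    -- With syl = c · ρ(D) and the evaluated determinant equal to c' · ρ(D) in degree δ, the unit is
    -- α = c'/c; it does not depend on i.
    have hα : rho f (MvPolynomial.homogeneousComponent (d - 2) (evalRight k H.det)) =
        (MvPolynomial.C ((c' * (Units.mk0 c hc0)⁻¹ : kˣ) : k) : MorleyForms.S k) • syl := by
      rw [hc', ← hc, smul_smul, ← MvPolynomial.C_mul, Units.val_mul, Units.val_inv_eq_inv_val,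
        Units.val_mk0, inv_mul_cancel_right₀ hc0]
    have h2 := bijective_muSyl hdata hD hc0
      (syl := ⟨syl, bidegA_le_degA f (d - 2) 2 hsyl⟩) hc
    refine ⟨h2, _, fun i j hij => ⟨fun u => nu2_nu1 hdata hH hij _ _ h2 hα u, fun a => ?_⟩⟩
    -- Applying ν₂ reduces the second identity to the first: ν₂(ν₁ν₂(a)) = α ν₂(a) = ν₂(α a).
    refine nu2_injective hdata hij _ h2 ?_
    rw [nu2_nu1 hdata hH hij _ _ h2 hα, map_smul]
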